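/- **Conventions.** $\operatorname{acl}$ is model-theoretic algebraic closure. A structure is *geometric* if in all models of its theory $\operatorname{acl}$ satisfies exchange and the quantifier $\exists^\infty$ is eliminated. For a finite tuple $a$, $\dim(a/A)$ is the length of a maximal $\operatorname{acl}$-independent over $A$ subtuple of $a$; for an $A$-definable set $X$, $\dim X=\max\{\dim(x/A):x\in X\}$; $x\in X$ is *generic in $X$ over $A$* if $\dim(x/A)=\dim X$; $a,b$ are *independent over $A$* if $\dim(a/Ab)=\dim(a/A)$. All parameter sets $A,B,\dots$ are countable. $\operatorname{Fr}(X)=\overline X\setminus X$. A *Hausdorff geometric structure* $(\mathcal K,\tau)$ is an $\aleph_1$-saturated geometric structure $\mathcal K$ (in any language) with a Hausdorff topology $\tau$ on $K$ (powers of $K$ get the product topology) such that: (i) if $X\subseteq K^n$ is $A$-definable and $a\in\overline{\operatorname{Fr}(X)}$, then $\dim(a/A)<\dim X$; (ii) if $X\subseteq K^n$ is $A$-definable, $a$ is generic in $X$ over $A$ and $B\supseteq A$, then every neighborhood of $a$ contains a generic of $X$ over $B$; (iii) if $X$, $Y$ and $Z\subseteq X\times Y$ are $A$-definable of the same dimension,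 both projections $Z\to X$, $Z\to Y$ are finite-to-one, and $(x,y)$ is generic in $Z$ over $A$, then there are open neighborhoods $U$ of $x$ in $X$ and $V$ of $y$ in $Y$ such that $Z\cap(U\times V)$ is the graph of a homeomorphism $U\to V$. Let $\mathcal M=(M,\dots)$ be a definable $\mathcal K$-relic: $M\subseteq K^d$ for some $d$, and there is a countable $P\subseteq K$ such that every subset of a power of $M$ that is $\emptyset$-definable in $\mathcal M$ is $P$-definable in $\mathcal K$. Fix such a $P$ and name its elements as constants of $\mathcal K$ (so below, notions in the sense of $\mathcal K$ are over $P$ together with the displayed parameters). Assume that $\mathcal M$ is strongly minimal. Let $\operatorname{rk}$ denote the dimension of $\mathcal M$; *$\mathcal M$-independent*, *$\mathcal M$-dependent* and *$\mathcal M(A)$-definable*, where $A\subseteq M$, are in the sense of $\mathcal M$, whereas *generic* and *independent* are in the sense of $\mathcal K$. A *plane curve* is an $\mathcal M$-definable $C\subseteq M^2$ of rank $1$. A family of plane curves $\{C_t:t\in T\}$, with $T\subseteq M^m$ and with graph $C=\{(x,t):x\in C_t\}$, is *$\mathcal M(A)$-definable* if $T$ and $C$ are, *almost faithful* if for each $t\in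 T$ there are only finitely many $t'\in T$ with $\operatorname{rk}(C_t\cap C_{t'})=1$, and its rank is $\operatorname{rk}(T)$. Assume that $\mathcal M$ is not locally modular, i.e. it admits a definable (with parameters) almost faithful family of plane curves of rank $2$. A *standard family over $A$* is an almost faithful $\mathcal M(A)$-definable family of plane curves with $m=\operatorname{rk}(T)\ge1$ (so $T$ is generic in $M^m$) such that $\operatorname{rk}\{t\in T:x\in C_t\}\le m-1$ for every $x\in M^2$. $\mathcal M$ *weakly detects closures* if whenever $X\subseteq M^n$ is $\mathcal M(A)$-definable of rank $r$ and $x=(x_1,\dots,x_n)\in\overline X\cap M^n$ with each $x_i$ generic in $M$ over $\emptyset$, one has $\operatorname{rk}(x/A)\le r$, and moreover either $\operatorname{rk}(x/A)<r$, or for all $i\ne j$ such that $y_i$ and $y_j$ are independent over $A$ for every $y\in X$ generic over $A$, the elements $x_i$ and $x_j$ are $\mathcal M$-independent over $A$. For standard families $\mathcal C=\{C_t:t\in T\}$ and $\mathcal D=\{D_u:u\in U\}$ over $A$, with graphs $C\subseteq M^2\times T$ and $D\subseteq M^2\times U$, a *generic multiple $(\mathcal C,\mathcal D)$-intersection over $A$*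 is a tuple $(x,t,u)$ such that $x\in M^2$, $t\in T$, $u\in U$, $(x,t)\in C$ and $(x,u)\in D$ are all generic over $A$, and, writing $I=\{(x',t',u'):x'\in C_{t'}\cap D_{u'}\}$, the pair $((x,t,u),(x,t,u))$ lies in the closure of the set of pairs $(w,w')\in I^2$ with $w\ne w'$ having the same image in $T\times U$. **Theorem.** Let $(\mathcal K,\tau)$ be a Hausdorff geometric structure and let $\mathcal M$ be a non-locally modular strongly minimal definable $\mathcal K$-relic as above. If $\mathcal M$ weakly detects closures, then $\mathcal M$ *detects multiple intersections*: whenever $\mathcal C$ and $\mathcal D$ are standard families of plane curves over $A$ and $(x,t,u)$ is a generic multiple $(\mathcal C,\mathcal D)$-intersection over $A$, the parameters $t$ and $u$ are $\mathcal M$-dependent over $A$. -/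

import Mathlib

open scoped FirstOrder Topology

universe u v u' v' w

namespace HGS

/-! ### Geometric structures: algebraic closure, dimension, genericity, independence -/

section Geometric

variable (L : FirstOrder.Language.{u, v}) {K : Type w} [L.Structure K]

/-- Model-theoretic algebraic closure: the union of the finite `A`-definable subsets of `K`. -/
def acl (A : Set K) : Set K :=
  {b | ∃ s : Set K, s.Finite ∧ A.Definable₁ L s ∧ b ∈ s}

/-- The subtuple of `a` with index set `S` is `acl`-independent over `A`. -/
def AclIndep {ι : Type*} (A : Set K) (a : ι → K) (S : Finset ι) : Prop :=
  ∀ i ∈ S, a i ∉ acl L (A ∪ a '' {j | j ∈ S ∧ j ≠ i})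

/-- `dim(a/A)` for a finite tuple `a` : the length of a longest subtuple of `a` which is
`acl`-independent over `A`. -/
noncomputable def dim {ι : Type*} (A : Set K) (a : ι → K) : ℕ :=
  sSup {k | ∃ S : Finset ι, AclIndep L A a S ∧ S.card = k}

/-- `dim(X) = max {dim(x/A) : x ∈ X}` for a set `X` definable over `A`. (In a saturated geometric
structure this does not depend on the small set `A` over which `X` is defined.) -/
noncomputable def dimSet {ι : Type*} (A : Set K) (X : Set (ι → K)) : ℕ :=
  sSup (dim L A '' X)

/-- `x` is a generic point of `X` over `A`. -/
def IsGeneric {ι : Type*} (A : Set K) (X : Set (ι → K)) (x : ι → K) : Prop :=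
  x ∈ X ∧ dim L A x = dimSet L A X

/-- The tuples `a` and `b` are independent over `A` : `dim(a/Ab) = dim(a/A)`. -/
def Indep {ι κ : Type*} (A : Set K) (a : ι → K) (b : κ → K) : Prop :=
  dim L (A ∪ Set.range b) a = dim L A a

variable (K)

/-- Exchange for `acl` in the structure `K`. -/
def Exchange : Prop :=
  ∀ (A : Set K) (b c : K), c ∈ acl L (A ∪ {b}) → c ∉ acl L A → b ∈ acl L (A ∪ {c})

/-- Elimination of `∃^∞` in the structure `K` : for every formula `φ(x, y)` with `x` a single
variable, the set of `b` with `φ(K, b)` finite is definable (with parameters). -/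
def EliminatesExistsInfinity : Prop :=
  ∀ (n : ℕ) (φ : L.Formula (Fin (n + 1))),
    (Set.univ : Set K).Definable L
      {b : Fin n → K | {a : K | φ.Realize (Fin.cons a b : Fin (n + 1) → K)}.Finite}

/-- `K` is geometric: all models of its complete theory satisfy exchange and eliminate `∃^∞`. -/
def IsGeometric : Prop :=
  ∀ (N : Type w) [L.Structure N], N ⊨ L.completeTheory K →
    Exchange L N ∧ EliminatesExistsInfinity L N

/-- `ℵ₁`-saturation: every finitely satisfiable set of formulas in finitely many variables over a
countable set of parameters is realized. -/
def IsAleph1Saturated : Prop :=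
  ∀ (A : Set K), A.Countable → ∀ (n : ℕ) (Φ : Set (L[[A]].Formula (Fin n))),
    (∀ Ψ : Finset (L[[A]].Formula (Fin n)), (Ψ : Set (L[[A]].Formula (Fin n))) ⊆ Φ →
      ∃ x : Fin n → K, ∀ φ ∈ Ψ, φ.Realize x) →
    ∃ x : Fin n → K, ∀ φ ∈ Φ, φ.Realize x

/-- Strong minimality: `K` is infinite and in every elementary extension every subset of the
universe which is definable with parameters is finite or cofinite. -/
def IsStronglyMinimal : Prop :=
  Infinite K ∧ ∀ (N : Type w) [L.Structure N], Nonempty (K ↪ₑ[L] N) →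
    ∀ s : Set N, (Set.univ : Set N).Definable₁ L s → s.Finite ∨ sᶜ.Finite

end Geometric

/-! ### Hausdorff geometric structures -/

/-- The frontier `Fr(X) = cl(X) \ X`. -/
def Fr {E : Type*} [TopologicalSpace E] (X : Set E) : Set E := closure X \ X

/-- `(K, τ)` is a Hausdorff geometric structure. Powers of `K` carry the product topology; sets of
parameters are countable. -/
structure IsHausdorffGeometric (L : FirstOrder.Language.{u, v}) (K : Type w) [L.Structure K]
    [TopologicalSpace K] : Prop where
  hausdorff : T2Space K
  geometric : IsGeometric L K
  saturated : IsAleph1Saturated L K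
  /-- Strong frontier inequality. -/
  strong_frontier : ∀ (n : ℕ) (A : Set K), A.Countable → ∀ X : Set (Fin n → K),
    A.Definable L X → ∀ a ∈ closure (Fr X), dim L A a < dimSet L A X
  /-- Baire category axiom. -/
  baire : ∀ (n : ℕ) (A B : Set K), A.Countable → B.Countable → A ⊆ B →
    ∀ X : Set (Fin n → K), A.Definable L X → ∀ a, IsGeneric L A X a →
      ∀ U ∈ 𝓝 a, ∃ b ∈ U, IsGeneric L B X b
  /-- Generic local homeomorphism property. -/
  generic_local_homeo : ∀ (m n : ℕ) (A : Set K), A.Countable →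
    ∀ (X : Set (Fin m → K)) (Y : Set (Fin n → K)) (Z : Set (Fin m ⊕ Fin n → K)),
      A.Definable L X → A.Definable L Y → A.Definable L Z →
      (∀ x y, Sum.elim x y ∈ Z → x ∈ X ∧ y ∈ Y) →
      dimSet L A X = dimSet L A Z → dimSet L A Y = dimSet L A Z →
      (∀ x, {y | Sum.elim x y ∈ Z}.Finite) → (∀ y, {x | Sum.elim x y ∈ Z}.Finite) →
      ∀ x y, IsGeneric L A Z (Sum.elim x y) →
        ∃ (U : Set (Fin m → K)) (V : Set (Fin n → K)),
          IsOpen U ∧ IsOpen V ∧ x ∈ U ∧ y ∈ V ∧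
          ∃ h : ↥(X ∩ U) ≃ₜ ↥(Y ∩ V), ∀ (p : ↥(X ∩ U)) (q : ↥(Y ∩ V)),
            Sum.elim (p : Fin m → K) (q : Fin n → K) ∈ Z ↔ h p = q

/-! ### Families of plane curves in a strongly minimal structure

For a strongly minimal structure `M`, `dim` and `dimSet` are the rank `rk` of tuples and sets. -/

section Families

variable (L : FirstOrder.Language.{u, v}) {M : Type w} [L.Structure M]

/-- The member `C_t` of the family with graph `C`. -/
def fiber {α β : Type*} (C : Set (α ⊕ β → M)) (t : β → M) : Set (α → M) :=
  {x | Sum.elim x t ∈ C}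

/-- `C ⊆ M² × T` is the graph of an almost faithful family of plane curves, definable over `A` :
each `C_t` has rank one, and for each `t` there are only finitely many `t'` such that
`C_t ∩ C_t'` has rank one. -/
structure IsAlmostFaithfulFamily {m : ℕ} (A : Set M) (T : Set (Fin m → M))
    (C : Set (Fin 2 ⊕ Fin m → M)) : Prop where
  definable_param : A.Definable L T
  definable_graph : A.Definable L C
  subset : ∀ x t, Sum.elim x t ∈ C → t ∈ T
  plane_curve : ∀ t ∈ T, dimSet L (A ∪ Set.range t) (fiber C t) = 1
  almost_faithful : ∀ t ∈ T,
    {t' | t' ∈ T ∧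
      dimSet L (A ∪ Set.range t ∪ Set.range t') (fiber C t ∩ fiber C t') = 1}.Finite

/-- A standard family of plane curves over `A`, with parameter set `T ⊆ M^m`, `m = rk(T) ≥ 1`. -/
structure IsStandardFamily {m : ℕ} (A : Set M) (T : Set (Fin m → M))
    (C : Set (Fin 2 ⊕ Fin m → M)) : Prop extends IsAlmostFaithfulFamily L A T C where
  one_le : 1 ≤ m
  generic_param : dimSet L A T = m
  point_condition : ∀ x : Fin 2 → M,
    dimSet L (A ∪ Set.range x) {t | Sum.elim x t ∈ C} + 1 ≤ m

variable (M)

/-- `M` is not locally modular: it has a rank two almost faithful family of plane curves, definable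
with parameters. -/
def NotLocallyModular : Prop :=
  ∃ (m : ℕ) (A : Set M) (T : Set (Fin m → M)) (C : Set (Fin 2 ⊕ Fin m → M)),
    A.Finite ∧ IsAlmostFaithfulFamily L A T C ∧ dimSet L A T = 2

end Families

/-! ### Relics -/

section Relics

variable {K : Type w} {d : ℕ} {M : Set (Fin d → K)}

/-- A tuple from `M ⊆ K^d`, viewed as a tuple from `K`. -/
def flat {ι : Type*} (x : ι → M) : ι × Fin d → K := fun p => (x p.1 : Fin d → K) p.2

/-- The set of coordinates in `K` of the elements of a set `A ⊆ M`. -/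
def coords (A : Set M) : Set K := {k | ∃ a ∈ A, ∃ i, (a : Fin d → K) i = k}

variable (L : FirstOrder.Language.{u, v}) [L.Structure K] (L' : FirstOrder.Language.{u', v'})

/-- The structure with universe `M ⊆ K^d` is a definable relic of `K`, defined over the set `P` of
parameters from `K` : each set `∅`-definable in `M` is definable over `P` in `K`. -/
def IsRelic (P : Set K) (M : Set (Fin d → K)) [L'.Structure M] : Prop :=
  ∀ (n : ℕ) (X : Set (Fin n → M)), (∅ : Set M).Definable L' X → P.Definable L (flat '' X)

/-- `x` is generic in `X` over `A` in the sense of `K`, where `X` is a set of tuples from `M` and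
`A ⊆ M`. The elements of `P` are treated as named constants of `K`. -/
def KGeneric {ι : Type*} (P : Set K) (A : Set M) (X : Set (ι → M)) (x : ι → M) : Prop :=
  IsGeneric L (P ∪ coords A) (flat '' X) (flat x)

/-- Each coordinate `x i` is generic in `M` over `∅` in the sense of `K` (with constants `P`). -/
def CoordinatewiseGeneric {n : ℕ} (P : Set K) (x : Fin n → M) : Prop :=
  ∀ i, IsGeneric L P M (x i : Fin d → K)

/-- The `i`th and `j`th projections `M^n → M` are independent on the `M(A)`-definable set `X`. -/
def IndepProjections {n : ℕ} (P : Set K) (A : Set M) (X : Set (Fin n → M)) (i j : Fin n) : Prop :=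
  ∀ x, KGeneric L P A X x → Indep L (P ∪ coords A) (x i : Fin d → K) (x j : Fin d → K)

/-- `M` weakly detects closures. Here `rk(x/A)` is `dim L' A x`, the rank of `X` is `dimSet L' A X`,
and closures are taken in `M^n ⊆ (K^d)^n`. -/
def WeaklyDetectsClosures [TopologicalSpace K] (P : Set K) (M : Set (Fin d → K))
    [L'.Structure M] : Prop :=
  ∀ (n : ℕ) (A : Set M), A.Countable → ∀ X : Set (Fin n → M), A.Definable L' X →
    ∀ x ∈ closure X, CoordinatewiseGeneric L P x →
      dim L' A x ≤ dimSet L' A X ∧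
      (dim L' A x < dimSet L' A X ∨
        ∀ i j, i ≠ j → IndepProjections L P A X i j →
          Indep L' A (fun _ : Fin 1 => x i) (fun _ : Fin 1 => x j))

/-- `(x, t, u)` is a weakly generic `(Y, Z)`-intersection over `A`, for families of subsets of `M²`
with graphs `Y ⊆ M² × T` and `Z ⊆ M² × U`. -/
structure IsWeaklyGenericIntersection {m k : ℕ} (P : Set K) (A : Set M)
    (T : Set (Fin m → M)) (Y : Set (Fin 2 ⊕ Fin m → M))
    (U : Set (Fin k → M)) (Z : Set (Fin 2 ⊕ Fin k → M))
    (x : Fin 2 → M) (t : Fin m → M) (u : Fin k → M) : Prop where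
  generic_point : KGeneric L P A Set.univ x
  generic_left : KGeneric L P A T t
  generic_right : KGeneric L P A U u
  generic_left_graph : KGeneric L P A Y (Sum.elim x t)
  generic_right_graph : KGeneric L P A Z (Sum.elim x u)

/-- `x₀` is a topological ramification point of the restriction of `f` to `X`. -/
def IsTopologicalRamificationPoint {E F : Type*} [TopologicalSpace E] (X : Set E) (f : E → F)
    (x₀ : E) : Prop :=
  x₀ ∈ X ∧ (x₀, x₀) ∈ closure {p : E × E | p.1 ∈ X ∧ p.2 ∈ X ∧ p.1 ≠ p.2 ∧ f p.1 = f p.2}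

/-- `(x, t, u)` is a generic multiple `(Y, Z)`-intersection over `A` : a weakly generic one which is
a topological ramification point of `{(x', t', u') : x' ∈ Y_t' ∩ Z_u'} → T × U`. -/
def IsGenericMultipleIntersection [TopologicalSpace K] {m k : ℕ} (P : Set K) (A : Set M)
    (T : Set (Fin m → M)) (Y : Set (Fin 2 ⊕ Fin m → M))
    (U : Set (Fin k → M)) (Z : Set (Fin 2 ⊕ Fin k → M))
    (x : Fin 2 → M) (t : Fin m → M) (u : Fin k → M) : Prop :=
  IsWeaklyGenericIntersection L P A T Y U Z x t u ∧
  IsTopologicalRamificationPoint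
    {q : (Fin 2 → M) × (Fin m → M) × (Fin k → M) |
      Sum.elim q.1 q.2.1 ∈ Y ∧ Sum.elim q.1 q.2.2 ∈ Z}
    Prod.snd (x, t, u)

/-- `M` detects multiple intersections: the parameters `t`, `u` of any generic multiple intersection
of two standard families of plane curves over `A` are `M`-dependent over `A`. -/
def DetectsMultipleIntersections [TopologicalSpace K] (P : Set K) (M : Set (Fin d → K))
    [L'.Structure M] : Prop :=
  ∀ (A : Set M), A.Countable → ∀ (m k : ℕ)
    (T : Set (Fin m → M)) (C : Set (Fin 2 ⊕ Fin m → M))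
    (U : Set (Fin k → M)) (D : Set (Fin 2 ⊕ Fin k → M)),
    IsStandardFamily L' A T C → IsStandardFamily L' A U D →
    ∀ x t u, IsGenericMultipleIntersection L P A T C U D x t u → ¬ Indep L' A t u

end Relics

end HGS

namespace HGS

/-! ### Definable fibres and counting their points. -/

section Definability

variable {L : FirstOrder.Language.{u, v}} {K : Type w} [L.Structure K] {A B : Set K}

/-! Suppose `t` and `u` were `M`-independent over `A`, so that `(t, u)` has rank `m + k`. Let `X` be
the set of all `(x₁, x₂, s, w)` with `x₁ ≠ x₂` both in `C_s ∩ D_w`. The ramification hypothesis says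
exactly that `y₀ = (x, x, t, u)` lies in the closure of `X`. By compactness it is enough to put each
`y ∈ X` into an `M(A)`-definable set whose closure misses `y₀`: finitely many of these sets then
cover `X`, and closure commutes with finite unions.

Let `y = (x₁, x₂, s, w) ∈ X`. There are three cases.

If `(s, w)` has rank below `m + k`, it lies in an `M(A)`-definable set of smaller rank, and the rank
clause of weak detection keeps `(t, u)` out of the closure.

If `(s, w)` has full rank, rank counting in standard families makes `x₁` generic in the plane and
`x₁`, `x₂` algebraic over `s, w` (`two_le_dim_of_mem_inter`, `mem_acl_of_mem_inter`). When `x₂` is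
also algebraic over `x₁`, only the pair `(x₁, x₂)` matters: a limit `(x, x)` of such distinct pairs
would be a frontier point of dimension at least that of the whole set, against the frontier
inequality (`notMem_closure_of_finite_fibers`).

Otherwise some coordinate `x₂ i` is not algebraic over `x₁`, so `x₁ i` and `x₂ i` belong to a common
`M`-basis of `y`. On a suitable definable set around `y` these two projections are independent in
the sense of `K`. At `y₀` the rank cannot drop, so the second clause of weak detection would make `x
i` independent from itself, hence algebraic, although `x` is generic (`notMem_closure_of_basis`).

The passage between the two structures rests on one computation: a tuple of `M`-rank `r` has
`K`-dimension at most `r · dim M`, and equality is attained at generics because independent tuples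
of a strongly minimal structure share their type. -/

theorem exists_definable_of_definable_union_range {α κ : Type*} {b : κ → K} {s : Set (α → K)}
    (hs : (A ∪ Set.range b).Definable L s) :
    ∃ Z : Set (α ⊕ κ → K), A.Definable L Z ∧ ∀ x, x ∈ s ↔ Sum.elim x b ∈ Z := by
  classical
  rw [Set.definable_iff_exists_formula_sum] at hs
  obtain ⟨φ, rfl⟩ := hs
  have hc : ∀ c : ↥(A ∪ Set.range b), ∃ i : A ⊕ (α ⊕ κ),
      ∀ x : α → K, Sum.elim (Subtype.val : A → K) (Sum.elim x b) i = c := by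
    rintro ⟨c, hc | ⟨k, rfl⟩⟩
    · exact ⟨Sum.inl ⟨c, hc⟩, fun _ => rfl⟩
    · exact ⟨Sum.inr (Sum.inr k), fun _ => rfl⟩
  choose g hg using hc
  refine ⟨{w | (φ.relabel (Sum.elim g fun a => Sum.inr (Sum.inl a))).Realize
    (Sum.elim Subtype.val w)}, Set.definable_iff_exists_formula_sum.2 ⟨_, rfl⟩, fun x => ?_⟩
  simp only [Set.mem_ofPred_eq, FirstOrder.Language.Formula.realize_relabel]
  refine iff_of_eq (congrArg _ (funext fun i => ?_))
  rcases i with c | a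
  · exact (hg c x).symm
  · rfl

theorem definable_fiber {α κ : Type*} [Finite α] [Finite κ] {b : κ → K} (hb : ∀ k, b k ∈ A)
    {Z : Set (α ⊕ κ → K)} (hZ : A.Definable L Z) : A.Definable L {x | Sum.elim x b ∈ Z} := by
  refine Set.Definable.preimage_map (F := fun x : α → K => Sum.elim x b) (fun i => ?_) hZ
  rcases i with a | k
  · exact Set.DefinableFun.proj L
  · exact L.definableFun_const _ (hb k)

theorem definable_fiber_union_range {α κ : Type*} [Finite α] [Finite κ] (b : κ → K)
    {Z : Set (α ⊕ κ → K)} (hZ : A.Definable L Z) :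
    (A ∪ Set.range b).Definable L {x | Sum.elim x b ∈ Z} :=
  definable_fiber (A := A ∪ Set.range b) (fun k => Set.mem_union_right _ (Set.mem_range_self k))
    (hZ.mono Set.subset_union_left)

theorem definable_eq_coord {α : Type*} (i j : α) : A.Definable L {x : α → K | x i = x j} :=
  Set.DefinableFun.ofPred_eq (Set.DefinableFun.proj L) (Set.DefinableFun.proj L)

/-- For fixed `N` the condition is first order: it asks for `N` pairwise distinct points of the
fibre, quantified as a block of variables indexed by `Fin N × α`. -/
theorem definable_le_encard_fiber {α κ : Type*} [Finite α] {Z : Set (α ⊕ κ → K)}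
    (hZ : A.Definable L Z) (N : ℕ) :
    A.Definable L {b : κ → K | (N : ℕ∞) ≤ {x | Sum.elim x b ∈ Z}.encard} := by
  have h1 : A.Definable L {w : κ ⊕ (Fin N × α) → K |
      ∀ i : Fin N, w ∘ Sum.elim (fun a => Sum.inr (i, a)) Sum.inl ∈ Z} := by
    rw [Set.ofPred_forall]
    exact Set.definable_iInter_of_finite fun i => hZ.preimage_comp _
  have h2 : A.Definable L {w : κ ⊕ (Fin N × α) → K |
      ∀ p : Fin N × Fin N, p.1 ≠ p.2 → ¬ ∀ a, w (Sum.inr (p.1, a)) = w (Sum.inr (p.2, a))} := by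
    rw [Set.ofPred_forall]
    refine Set.definable_iInter_of_finite fun p => ?_
    by_cases hp : p.1 = p.2
    · simp [hp]
    · have : A.Definable L {w : κ ⊕ (Fin N × α) → K |
          ∀ a, w (Sum.inr (p.1, a)) = w (Sum.inr (p.2, a))} := by
        rw [Set.ofPred_forall]
        exact Set.definable_iInter_of_finite fun a => definable_eq_coord _ _
      convert this.compl using 1
      ext w
      simp [hp]
  convert (h1.inter h2).exists_of_finite using 1
  ext b
  simp only [Set.mem_ofPred_eq, Set.mem_inter_iff]
  constructor
  · intro h
    obtain ⟨t, ht, hc⟩ := Set.exists_subset_encard_eq h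
    have hf : t.Finite := Set.finite_of_encard_eq_coe hc
    have hcard : Nat.card t = N := by
      rw [Nat.card_coe_set_eq, Set.ncard, hc]; rfl
    have e : Fin N ≃ t := by
      haveI := hf.to_subtype
      exact (Finite.equivFinOfCardEq hcard).symm
    refine ⟨fun p => (e p.1 : α → K) p.2, fun i => ?_, fun p hp h => hp ?_⟩
    · have : (Sum.elim b fun p : Fin N × α => (e p.1 : α → K) p.2) ∘
          Sum.elim (fun a => Sum.inr (i, a)) Sum.inl = Sum.elim (e i : α → K) b := by
        funext j; rcases j with j | j <;> rfl
      rw [this]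
      exact ht (e i).2
    · exact e.injective (Subtype.ext (funext h))
  · rintro ⟨u, h1, h2⟩
    have hinj : Function.Injective fun (i : Fin N) (a : α) => u (i, a) := by
      intro i j hij
      by_contra hne
      exact h2 (i, j) hne fun a => congrFun hij a
    have hsub : Set.range (fun (i : Fin N) (a : α) => u (i, a)) ⊆ {x | Sum.elim x b ∈ Z} := by
      rintro _ ⟨i, rfl⟩
      have := h1 i
      have h3 : (Sum.elim b u) ∘ Sum.elim (fun a => Sum.inr (i, a)) Sum.inl
          = Sum.elim (fun a => u (i, a)) b := by
        funext j; rcases j with j | j <;> rfl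
      rw [h3] at this
      exact this
    calc (N : ℕ∞) = (Set.univ : Set (Fin N)).encard := by simp
      _ = (Set.range fun (i : Fin N) (a : α) => u (i, a)).encard := by
        rw [← Set.image_univ, hinj.encard_image]
      _ ≤ _ := Set.encard_le_encard hsub

end Definability

/-! ### Algebraic closure and its definable witnesses. -/

section Acl

variable {L : FirstOrder.Language.{u, v}} {K : Type w} [L.Structure K] {A B : Set K}

theorem acl_mono (h : A ⊆ B) : acl L A ⊆ acl L B := fun _ ⟨s, hs, hd, hb⟩ => ⟨s, hs, hd.mono h, hb⟩

theorem subset_acl : A ⊆ acl L A := fun a ha =>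
  ⟨{a}, Set.finite_singleton a, Set.Definable.singleton_of_mem L ha, rfl⟩

theorem mem_acl_of_mem_finite {ι : Type*} [Finite ι] {X : Set (ι → K)} (hX : X.Finite)
    (hd : A.Definable L X) {x : ι → K} (hx : x ∈ X) (i : ι) : x i ∈ acl L A := by
  refine ⟨(fun y : ι → K => y i) '' X, hX.image _, ?_, x, hx, rfl⟩
  refine (congrArg (A.Definable L) (Set.ext fun y => ?_)).mp
    (hd.image_comp (fun _ : Fin 1 => i))
  simp only [Set.mem_ofPred_eq, Set.mem_image]
  refine exists_congr fun z => and_congr_right fun _ => ⟨fun h => ?_, fun h => ?_⟩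
  · exact congrFun h 0
  · funext j; rw [Subsingleton.elim j 0]; exact h

theorem exists_finite_definable_of_forall_mem_acl {ι : Type*} [Finite ι] {x : ι → K}
    (hx : ∀ i, x i ∈ acl L A) : ∃ X : Set (ι → K), X.Finite ∧ A.Definable L X ∧ x ∈ X := by
  choose s hs hd hb using hx
  refine ⟨{y | ∀ i, y i ∈ s i}, ?_, ?_, hb⟩
  · exact (Set.Finite.pi' hs)
  · rw [Set.ofPred_forall]
    refine Set.definable_iInter_of_finite fun i => ?_
    exact (hd i).preimage_comp fun _ : Fin 1 => i

theorem definable_encard_fiber_le {α κ : Type*} [Finite α] {Z : Set (α ⊕ κ → K)}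
    (hZ : A.Definable L Z) (N : ℕ) :
    A.Definable L {b : κ → K | {x | Sum.elim x b ∈ Z}.encard ≤ N} := by
  convert (definable_le_encard_fiber hZ (N + 1)).compl using 1
  ext b
  simp only [Set.mem_ofPred_eq, Set.mem_compl_iff, not_le, Nat.cast_add, Nat.cast_one]
  exact (ENat.lt_add_one_iff (ENat.natCast_ne_top N)).symm

/-- An algebraic dependence `c ∈ acl(A b)` is witnessed by an `A`-definable set with finite
fibers. -/
theorem exists_definable_finite_fibers {κ : Type*} [Finite κ] {b : κ → K} {c : K}
    (h : c ∈ acl L (A ∪ Set.range b)) :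
    ∃ W : Set (Fin 1 ⊕ κ → K), A.Definable L W ∧ Sum.elim (fun _ => c) b ∈ W ∧
      ∀ b', {x | Sum.elim x b' ∈ W}.Finite := by
  obtain ⟨s, hs, hd, hc⟩ := h
  obtain ⟨Z, hZ, hsZ⟩ := exists_definable_of_definable_union_range hd
  have hfin : {x | Sum.elim x b ∈ Z}.Finite := by
    have : {x : Fin 1 → K | Sum.elim x b ∈ Z} = {x | x 0 ∈ s} := by
      ext x; exact (hsZ x).symm
    rw [this]
    refine Set.Finite.subset (Set.Finite.pi' fun _ : Fin 1 => hs) fun x hx i => ?_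
    rw [Subsingleton.elim i 0]; exact hx
  obtain ⟨N, hN⟩ := hfin.exists_encard_eq_coe
  -- Fibres of `Z` over other points may be infinite, so only those base points are kept whose fibre
  -- is no larger than the one over `b`.
  refine ⟨Z ∩ (fun w => w ∘ Sum.inr) ⁻¹' {b | {x | Sum.elim x b ∈ Z}.encard ≤ N},
    hZ.inter ((definable_encard_fiber_le hZ N).preimage_comp _), ⟨(hsZ _).1 hc, ?_⟩, fun b' => ?_⟩
  · simp only [Set.mem_preimage, Sum.elim_comp_inr]
    exact hN.le
  · by_cases hb : {x | Sum.elim x b' ∈ Z}.encard ≤ N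
    · exact (Set.finite_of_encard_le_coe hb).subset fun x hx => hx.1
    · convert Set.finite_empty
      rw [Set.eq_empty_iff_forall_notMem]
      intro x hx
      exact hb (by simpa using hx.2)

/-- Transitivity of `acl`: the finitely many parameters used range over a finite `A`-definable set,
and a family with finite fibres over a finite base has a finite union. -/
theorem acl_subset_of_subset_acl (h : B ⊆ acl L A) : acl L B ⊆ acl L A := by
  rintro c ⟨s, hs, hd, hc⟩
  obtain ⟨B0, hB0, hd⟩ := Set.definable_iff_finitely_definable.1 hd
  let b : B0 → K := Subtype.val
  have hb : Set.range b = B0 := by simp [b]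
  obtain ⟨W, hW, hcW, hfin⟩ := exists_definable_finite_fibers (A := A) (b := b) (c := c)
    ⟨s, hs, hd.mono (by rw [hb]; exact Set.subset_union_right), hc⟩
  obtain ⟨X, hX, hXd, hbX⟩ := exists_finite_definable_of_forall_mem_acl (A := A) (x := b)
    (L := L) (fun i => h (hB0 i.2))
  refine mem_acl_of_mem_finite (X := {x : Fin 1 → K | ∃ b', Sum.elim x b' ∈ W ∩
    (fun w => w ∘ Sum.inr) ⁻¹' X}) (x := fun _ => c) ?_
    (hW.inter (hXd.preimage_comp _)).exists_of_finite ⟨b, hcW, by simpa using hbX⟩ 0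
  refine (hX.biUnion fun b' _ => hfin b').subset ?_
  rintro x ⟨b', h1, h2⟩
  simp only [Set.mem_iUnion]
  exact ⟨b', by simpa using h2, h1⟩

/-- If the coordinates of `a` are algebraic over `A` and the coordinates in `S`, then this holds on
an `A`-definable set containing `a`. -/
theorem exists_definable_forall_mem_acl {ι : Type*} [Finite ι] {a : ι → K} {S : Set ι}
    (h : ∀ i, a i ∈ acl L (A ∪ a '' S)) :
    ∃ G : Set (ι → K), A.Definable L G ∧ a ∈ G ∧ ∀ b ∈ G, ∀ i, b i ∈ acl L (A ∪ b '' S) := by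
  have hr : ∀ b : ι → K, Set.range (fun j : S => b j) = b '' S := fun b => by
    ext; simp
  have h' : ∀ i, ∃ W : Set (Fin 1 ⊕ S → K), A.Definable L W ∧
      Sum.elim (fun _ => a i) (fun j : S => a j) ∈ W ∧
      ∀ b', {x | Sum.elim x b' ∈ W}.Finite := fun i =>
    exists_definable_finite_fibers (by rw [hr]; exact h i)
  choose W hW haW hfin using h'
  refine ⟨{b | ∀ i, b ∘ Sum.elim (fun _ => i) Subtype.val ∈ W i}, ?_, fun i => ?_,
    fun b hb i => ?_⟩
  · rw [Set.ofPred_forall]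
    exact Set.definable_iInter_of_finite fun i => (hW i).preimage_comp _
  · convert haW i using 1
    funext j; rcases j with j | j <;> rfl
  · have hd : (A ∪ b '' S).Definable L {x : Fin 1 → K | Sum.elim x (fun j : S => b j) ∈ W i} := by
      refine definable_fiber (fun j => ?_) ((hW i).mono Set.subset_union_left)
      exact Set.mem_union_right _ (Set.mem_image_of_mem b j.2)
    refine mem_acl_of_mem_finite (hfin i fun j => b j) hd (x := fun _ => b i) ?_ 0
    have hbi := hb i
    have : b ∘ Sum.elim (fun _ => i) (Subtype.val : S → ι)
        = Sum.elim (fun _ : Fin 1 => b i) (fun j : S => b j) := by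
      funext j; rcases j with j | j <;> rfl
    rwa [this] at hbi

end Acl

/-! ### Exchange, bases and additivity of dimension. -/

section Dimension

variable {L : FirstOrder.Language.{u, v}} {K : Type w} [L.Structure K] {A B : Set K}
  {ι κ : Type*} {a : ι → K} {b : κ → K}

theorem acl_union_subset {C : Set K} (hB : B ⊆ acl L (A ∪ C)) : acl L (A ∪ B) ⊆ acl L (A ∪ C) :=
  acl_subset_of_subset_acl (Set.union_subset (Set.subset_union_left.trans subset_acl) hB)

theorem AclIndep.of_subset_acl {S : Finset ι} (h : AclIndep L A a S) (hB : B ⊆ acl L A) :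
    AclIndep L B a S := fun i hi hc => h i hi <| by
  refine acl_subset_of_subset_acl (Set.union_subset ?_ ?_) hc
  · exact hB.trans (acl_mono Set.subset_union_left)
  · exact Set.subset_union_right.trans subset_acl

theorem AclIndep.subset {S S' : Finset ι} (h : AclIndep L A a S) (hS : S' ⊆ S) :
    AclIndep L A a S' := fun i hi hc => h i (hS hi) <| by
  refine acl_mono (Set.union_subset_union_right _ (Set.image_mono ?_)) hc
  exact fun j hj => ⟨hS hj.1, hj.2⟩

theorem AclIndep.insert [DecidableEq ι] (hex : Exchange L K) {S : Finset ι}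
    (h : AclIndep L A a S) {i : ι} (hi : a i ∉ acl L (A ∪ a '' S)) :
    AclIndep L A a (insert i S) := by
  intro j hj hc
  by_cases hij : j = i
  · subst hij
    refine hi (acl_mono (Set.union_subset_union_right _ (Set.image_mono ?_)) hc)
    rintro k ⟨hk, hkj⟩
    exact (Finset.mem_insert.1 hk).resolve_left hkj
  · have hjS : j ∈ S := (Finset.mem_insert.1 hj).resolve_left hij
    have h1 : a j ∈ acl L ((A ∪ a '' {k | k ∈ S ∧ k ≠ j}) ∪ {a i}) := by
      refine acl_mono (Set.union_subset (Set.subset_union_left.trans Set.subset_union_left) ?_) hc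
      rintro _ ⟨k, ⟨hk, hkj⟩, rfl⟩
      rcases Finset.mem_insert.1 hk with rfl | hk
      · exact Or.inr rfl
      · exact Or.inl (Or.inr ⟨k, ⟨hk, hkj⟩, rfl⟩)
    refine hi (acl_mono ?_ (hex _ _ _ h1 (h j hjS)))
    refine Set.union_subset (Set.union_subset_union_right _ (Set.image_mono fun k hk => hk.1)) ?_
    rintro _ rfl
    exact Or.inr ⟨j, hjS, rfl⟩

theorem AclIndep.union [DecidableEq ι] (hex : Exchange L K) {S S' : Finset ι}
    (h : AclIndep L A a S) (h' : AclIndep L (A ∪ a '' S) a S') : AclIndep L A a (S ∪ S') := by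
  induction S' using Finset.induction_on with
  | empty => simpa using h
  | insert i T hi ih =>
    have := (ih (h'.subset (Finset.subset_insert _ _))).insert hex (i := i) fun hc => by
      refine h' i (Finset.mem_insert_self _ _) (acl_mono ?_ hc)
      rw [Finset.coe_union, Set.image_union, ← Set.union_assoc]
      refine Set.union_subset_union_right _ (Set.image_mono fun k hk => ⟨?_, ?_⟩)
      · exact Finset.mem_insert_of_mem hk
      · rintro rfl; exact hi hk
    rwa [Finset.union_insert]

/-- The Steinitz exchange lemma. -/
theorem AclIndep.card_le (hex : Exchange L K) {S : Finset ι} (h : AclIndep L A a S)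
    (F : Finset K) (hF : ∀ i ∈ S, a i ∈ acl L (A ∪ F)) : S.card ≤ F.card := by
  classical
  induction F using Finset.induction_on generalizing A S with
  | empty =>
    rcases S.eq_empty_or_nonempty with rfl | ⟨i, hi⟩
    · simp
    · refine absurd (acl_mono ?_ (hF i hi)) (h i hi)
      simp
  | insert f F hf ih =>
    rw [Finset.card_insert_of_notMem hf]
    have hF' : ∀ i ∈ S, a i ∈ acl L ((A ∪ {f}) ∪ F) := fun i hi => by
      have := hF i hi
      rwa [Finset.coe_insert, Set.insert_eq, ← Set.union_assoc] at this
    by_cases hS : AclIndep L (A ∪ {f}) a S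
    · exact (ih hS hF').trans (Nat.le_succ _)
    -- If adding `f` to the parameters destroys independence, some `a i` is interalgebraic with `f`
    -- over the rest. Dropping `i` restores independence over `f`, which trades one index for one
    -- element of the spanning set.
    · simp only [AclIndep, not_forall, not_not] at hS
      obtain ⟨i, hi, hc⟩ := hS
      rw [Set.union_right_comm] at hc
      have hfa := hex _ _ _ hc (h i hi)
      have hind : AclIndep L (A ∪ {f}) a (S.erase i) := by
        intro j hj hjc
        obtain ⟨hji, hjS⟩ := Finset.mem_erase.1 hj
        rw [Set.union_right_comm] at hjc
        have hj' : a j ∉ acl L (A ∪ a '' {k | k ∈ S.erase i ∧ k ≠ j}) := fun h' =>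
          h.subset (Finset.erase_subset i S) j hj h'
        have hf' := hex _ _ _ hjc hj'
        refine h i hi (acl_subset_of_subset_acl ?_ hc)
        refine Set.union_subset subset_acl ?_
        rintro _ rfl
        refine acl_mono ?_ hf'
        refine Set.union_subset (Set.union_subset_union_right _ (Set.image_mono ?_)) ?_
        · rintro k ⟨hk, -⟩
          exact ⟨Finset.mem_of_mem_erase hk, Finset.ne_of_mem_erase hk⟩
        · rintro _ rfl
          exact Or.inr ⟨j, ⟨hjS, hji⟩, rfl⟩
      have := ih hind fun j hj => hF' j (Finset.mem_of_mem_erase hj)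
      rw [Finset.card_erase_of_mem hi] at this
      omega

theorem AclIndep.exists_basis [Finite ι] (hex : Exchange L K) {S : Finset ι}
    (h : AclIndep L A a S) :
    ∃ T, S ⊆ T ∧ AclIndep L A a T ∧ ∀ i, a i ∈ acl L (A ∪ a '' T) := by
  classical
  obtain ⟨T, hST, hT⟩ := (Set.toFinite {T : Finset ι | AclIndep L A a T}).exists_le_maximal h
  refine ⟨T, hST, hT.1, fun i => ?_⟩
  by_contra hi
  have hiT : i ∈ T := hT.2 (hT.1.insert hex hi) (Finset.subset_insert i T)
    (Finset.mem_insert_self i T)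
  exact hi (subset_acl (Or.inr ⟨i, hiT, rfl⟩))

theorem aclIndep_empty : AclIndep L A a ∅ := fun _ h => absurd h (Finset.notMem_empty _)

theorem dim_eq_card (hex : Exchange L K) {S : Finset ι} (h : AclIndep L A a S)
    (hS : ∀ i, a i ∈ acl L (A ∪ a '' S)) : dim L A a = S.card := by
  classical
  have hub : ∀ k ∈ {k | ∃ S : Finset ι, AclIndep L A a S ∧ S.card = k}, k ≤ S.card := by
    rintro _ ⟨T, hT, rfl⟩
    refine (hT.card_le hex (S.image a) fun i _ => ?_).trans Finset.card_image_le
    simpa using hS i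
  exact le_antisymm (csSup_le ⟨_, S, h, rfl⟩ hub) (le_csSup ⟨_, hub⟩ ⟨S, h, rfl⟩)

theorem exists_basis [Finite ι] (hex : Exchange L K) (A : Set K) (a : ι → K) :
    ∃ S : Finset ι, AclIndep L A a S ∧ (∀ i, a i ∈ acl L (A ∪ a '' S)) ∧ dim L A a = S.card := by
  obtain ⟨S, -, h, hS⟩ := (aclIndep_empty (L := L) (A := A) (a := a)).exists_basis hex
  exact ⟨S, h, hS, dim_eq_card hex h hS⟩

theorem dim_le_card_of_forall_mem_acl [Finite ι] (hex : Exchange L K) {F : Finset K}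
    (h : ∀ i, a i ∈ acl L (A ∪ F)) : dim L A a ≤ F.card := by
  obtain ⟨S, hS, -, h'⟩ := exists_basis (L := L) hex A a
  exact h' ▸ hS.card_le hex F fun i _ => h i

theorem dim_le_card_of_forall_mem_acl_image [Finite ι] (hex : Exchange L K) {S : Finset ι}
    (h : ∀ i, a i ∈ acl L (A ∪ a '' S)) : dim L A a ≤ S.card := by
  classical
  exact (dim_le_card_of_forall_mem_acl hex (F := S.image a) (by simpa using h)).trans
    Finset.card_image_le

theorem AclIndep.card_le_dim [Finite ι] (hex : Exchange L K) {S : Finset ι}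
    (h : AclIndep L A a S) : S.card ≤ dim L A a := by
  obtain ⟨T, hST, hT, hT'⟩ := h.exists_basis hex
  exact dim_eq_card hex hT hT' ▸ Finset.card_le_card hST

theorem dim_le_of_forall_mem_acl [Finite ι] [Finite κ] (hex : Exchange L K)
    (h : ∀ i, a i ∈ acl L (A ∪ Set.range b)) : dim L A a ≤ dim L A b := by
  classical
  obtain ⟨S, hS, hS', hd⟩ := exists_basis (L := L) hex A b
  rw [hd]
  refine (dim_le_card_of_forall_mem_acl hex (F := S.image b) fun i => ?_).trans
    Finset.card_image_le
  rw [Finset.coe_image]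
  exact acl_union_subset (Set.range_subset_iff.2 hS') (h i)

theorem dim_le_of_range_subset [Finite ι] [Finite κ] (hex : Exchange L K)
    (h : Set.range a ⊆ Set.range b) : dim L A a ≤ dim L A b :=
  dim_le_of_forall_mem_acl hex fun i => subset_acl (Or.inr (h ⟨i, rfl⟩))

theorem dim_le_of_subset_acl [Finite ι] (hex : Exchange L K) (a : ι → K) (hB : B ⊆ acl L A) :
    dim L A a ≤ dim L B a := by
  obtain ⟨S, hS, -, hd⟩ := exists_basis (L := L) hex A a
  exact hd ▸ (hS.of_subset_acl hB).card_le_dim hex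

theorem dim_anti [Finite ι] (hex : Exchange L K) (a : ι → K) (h : A ⊆ B) :
    dim L B a ≤ dim L A a := dim_le_of_subset_acl hex a (h.trans subset_acl)

theorem AclIndep.map {S : Finset κ} {f : κ ↪ ι} (h : AclIndep L A (a ∘ f) S) :
    AclIndep L A a (S.map f) := by
  intro i hi hc
  obtain ⟨j, hj, rfl⟩ := Finset.mem_map.1 hi
  refine h j hj (acl_mono (Set.union_subset_union_right _ ?_) hc)
  rintro _ ⟨k, ⟨hk, hkj⟩, rfl⟩
  obtain ⟨l, hl, rfl⟩ := Finset.mem_map.1 hk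
  exact ⟨l, ⟨hl, fun h => hkj (by rw [h])⟩, rfl⟩

/-- Additivity of dimension. -/
theorem dim_sumElim [Finite ι] [Finite κ] (hex : Exchange L K) (A : Set K) (a : ι → K)
    (b : κ → K) : dim L A (Sum.elim a b) = dim L (A ∪ Set.range b) a + dim L A b := by
  classical
  obtain ⟨S, hS, hS', hd⟩ := exists_basis (L := L) hex A b
  obtain ⟨T, hT, hT', hd'⟩ := exists_basis (L := L) hex (A ∪ Set.range b) a
  have him : Sum.elim a b '' (S.map Function.Embedding.inr : Finset (ι ⊕ κ)) = b '' S := by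
    ext; simp
  have him' : Sum.elim a b '' (T.map Function.Embedding.inl : Finset (ι ⊕ κ)) = a '' T := by
    ext; simp
  have h1 : AclIndep L A (Sum.elim a b) (S.map Function.Embedding.inr) := AclIndep.map hS
  have h2 : AclIndep L (A ∪ Set.range b) (Sum.elim a b) (T.map Function.Embedding.inl) :=
    AclIndep.map hT
  -- A basis of `a` over `A ∪ b` stays independent over `A` and the chosen basis of `b`, so the two
  -- bases together form one of the pair.
  have h3 := h1.union hex (h2.of_subset_acl (B := A ∪ Sum.elim a b '' _) (by
    rw [him]
    exact (Set.union_subset_union_right _ (Set.image_subset_range _ _)).trans subset_acl))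
  have hb : ∀ k, b k ∈ acl L (A ∪ (a '' T ∪ b '' S)) := fun k =>
    acl_mono (Set.union_subset_union_right _ Set.subset_union_right) (hS' k)
  rw [dim_eq_card hex h3, Finset.card_union_of_disjoint, Finset.card_map, Finset.card_map, hd, hd',
    add_comm]
  · rw [Finset.disjoint_left]
    simp
  · rw [Finset.coe_union, Set.image_union, him, him', Set.union_comm (b '' _)]
    rintro (i | k)
    · refine acl_subset_of_subset_acl ?_ (hT' i)
      refine Set.union_subset (Set.union_subset (Set.subset_union_left.trans subset_acl)
        (Set.range_subset_iff.2 hb)) ?_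
      exact Set.subset_union_left.trans (Set.subset_union_right.trans subset_acl)
    · exact hb k

theorem dim_eq_zero_iff [Finite ι] (hex : Exchange L K) :
    dim L A a = 0 ↔ ∀ i, a i ∈ acl L A := by
  constructor
  · intro h i
    obtain ⟨S, -, hS, hd⟩ := exists_basis (L := L) hex A a
    rw [h] at hd
    obtain rfl := Finset.card_eq_zero.1 hd.symm
    simpa using hS i
  · intro h
    simpa using dim_le_card_of_forall_mem_acl (F := ∅) hex (A := A) (a := a) (by simpa using h)

theorem dim_le_card [Fintype ι] (hex : Exchange L K) (A : Set K) (a : ι → K) :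
    dim L A a ≤ Fintype.card ι := by
  obtain ⟨S, -, -, hd⟩ := exists_basis (L := L) hex A a
  exact hd ▸ S.card_le_univ

theorem bddAbove_dim_image [Finite ι] (hex : Exchange L K) (A : Set K) (X : Set (ι → K)) :
    BddAbove (dim L A '' X) := by
  cases nonempty_fintype ι
  exact ⟨Fintype.card ι, by rintro _ ⟨x, -, rfl⟩; exact dim_le_card hex A x⟩

theorem dim_le_dimSet [Finite ι] (hex : Exchange L K) {X : Set (ι → K)} (ha : a ∈ X) :
    dim L A a ≤ dimSet L A X :=
  le_csSup (bddAbove_dim_image hex A X) ⟨a, ha, rfl⟩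

theorem dimSet_le {X : Set (ι → K)} {n : ℕ} (h : ∀ x ∈ X, dim L A x ≤ n) : dimSet L A X ≤ n :=
  csSup_le' (by rintro _ ⟨x, hx, rfl⟩; exact h x hx)

theorem exists_dim_eq_dimSet [Finite ι] (hex : Exchange L K) {X : Set (ι → K)}
    (hX : X.Nonempty) : ∃ x ∈ X, dim L A x = dimSet L A X :=
  Nat.sSup_mem (hX.image _) (bddAbove_dim_image hex A X)

end Dimension

/-! ### Compactness, and moving points without loss of dimension. -/

section Saturation

variable {L : FirstOrder.Language.{u, v}} {K : Type w} [L.Structure K] {A B : Set K}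

theorem IsAleph1Saturated.sInter_nonempty (h : IsAleph1Saturated L K) (hA : A.Countable)
    {ι : Type*} [Finite ι] {𝓕 : Set (Set (ι → K))} (hd : ∀ X ∈ 𝓕, A.Definable L X)
    (hfin : ∀ 𝓖 ⊆ 𝓕, 𝓖.Finite → (⋂₀ 𝓖).Nonempty) : (⋂₀ 𝓕).Nonempty := by
  classical
  obtain ⟨n, ⟨e⟩⟩ := Finite.exists_equiv_fin ι
  obtain ⟨x, hx⟩ := h A hA n {φ | {x : ι → K | φ.Realize (x ∘ e.symm)} ∈ 𝓕} fun Ψ hΨ => by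
    obtain ⟨x, hx⟩ := hfin ((fun φ : L[[A]].Formula (Fin n) => {x : ι → K | φ.Realize (x ∘ e.symm)}) '' Ψ)
      (by rintro _ ⟨φ, hφ, rfl⟩; exact hΨ hφ) (Ψ.finite_toSet.image _)
    exact ⟨x ∘ e.symm, fun φ hφ => hx _ ⟨φ, hφ, rfl⟩⟩
  refine ⟨x ∘ e, fun X hX => ?_⟩
  obtain ⟨φ, hφ⟩ := (hd X hX).image_comp_equiv e.symm
  have hφX : X = {x : ι → K | φ.Realize (x ∘ e.symm)} := by
    ext y
    have h1 : y ∘ e.symm ∈ (fun g : ι → K => g ∘ e.symm) '' X ↔ y ∈ X :=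
      Function.Injective.mem_set_image e.symm.surjective.injective_comp_right
    rw [← h1, hφ]
    rfl
  have := hx φ (by rw [Set.mem_ofPred_eq, ← hφX]; exact hX)
  rw [hφX, Set.mem_ofPred_eq]
  convert this using 1
  funext i; simp

/-- If no finite subfamily covered `X`, then `X` and the complements would be finitely satisfiable,
and saturation would give an uncovered point. -/
theorem IsAleph1Saturated.exists_finite_cover (h : IsAleph1Saturated L K) (hA : A.Countable)
    {ι : Type*} [Finite ι] {X : Set (ι → K)} (hX : A.Definable L X) {𝓕 : Set (Set (ι → K))}
    (hd : ∀ Y ∈ 𝓕, A.Definable L Y) (hc : X ⊆ ⋃₀ 𝓕) :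
    ∃ 𝓖 ⊆ 𝓕, 𝓖.Finite ∧ X ⊆ ⋃₀ 𝓖 := by
  by_contra! hcon
  obtain ⟨x, hx⟩ := h.sInter_nonempty hA (𝓕 := insert X (compl '' 𝓕)) (by
    rintro _ (rfl | ⟨Y, hY, rfl⟩)
    · exact hX
    · exact (hd Y hY).compl) fun 𝓖 h𝓖 hf => by
    have h1 := hcon (𝓕 ∩ compl ⁻¹' 𝓖) Set.inter_subset_left
      ((hf.preimage compl_injective.injOn).subset Set.inter_subset_right)
    obtain ⟨x, hxX, hx⟩ := Set.not_subset.1 h1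
    refine ⟨x, fun Y hY => ?_⟩
    rcases h𝓖 hY with rfl | ⟨Z, hZ, rfl⟩
    · exact hxX
    · exact fun hxZ => hx ⟨Z, ⟨hZ, hY⟩, hxZ⟩
  obtain ⟨Y, hY, hxY⟩ := hc (hx X (Set.mem_insert _ _))
  exact hx Yᶜ (Set.mem_insert_of_mem _ ⟨Y, hY, rfl⟩) hxY

/-- An infinite definable set has a point with a coordinate outside the algebraic closure. -/
theorem IsAleph1Saturated.exists_notMem_acl (h : IsAleph1Saturated L K) (hA : A.Countable)
    {ι : Type*} [Finite ι] {X : Set (ι → K)} (hX : A.Definable L X) (hinf : X.Infinite) :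
    ∃ x ∈ X, ∃ i, x i ∉ acl L A := by
  by_contra! hcon
  obtain ⟨𝓖, h𝓖, hf, hc⟩ := h.exists_finite_cover hA hX
    (𝓕 := {Y | Y.Finite ∧ A.Definable L Y}) (fun Y hY => hY.2) fun x hx => by
      obtain ⟨Y, hY, hYd, hxY⟩ := exists_finite_definable_of_forall_mem_acl (hcon x hx)
      exact ⟨Y, ⟨hY, hYd⟩, hxY⟩
  exact hinf ((hf.sUnion fun Y hY => (h𝓖 hY).1).subset hc)

theorem sumElim_comp_insert {ι : Type*} [DecidableEq ι] {i : ι} {S : Finset ι} :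
    ∃ e : ↥(insert i S) → Fin 1 ⊕ S, ∀ a : ι → K,
      Sum.elim (fun _ : Fin 1 => a i) (fun j : S => a j) ∘ e
        = fun j : ↥(insert i S) => a j := by
  refine ⟨fun j => if h : (j : ι) ∈ S then Sum.inr ⟨j, h⟩ else Sum.inl 0, fun a => ?_⟩
  funext j
  by_cases h : (j : ι) ∈ S
  · simp [h]
  · have : (j : ι) = i := (Finset.mem_insert.1 j.2).resolve_right h
    have hi : i ∉ S := this ▸ h
    simp [hi, this]

theorem AclIndep.congr {ι : Type*} {a b : ι → K} {S : Finset ι} (h : AclIndep L A a S)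
    (hab : ∀ i ∈ S, a i = b i) : AclIndep L A b S := fun i hi hc => h i hi <| by
  have : b '' {j | j ∈ S ∧ j ≠ i} = a '' {j | j ∈ S ∧ j ≠ i} :=
    Set.image_congr fun j hj => (hab j hj.1).symm
  rwa [hab i hi, ← this]

theorem infinite_fiber_of_notMem_acl {κ : Type*} [Finite κ] {b : κ → K} {c : K}
    (hc : c ∉ acl L (A ∪ Set.range b)) {Z : Set (Fin 1 ⊕ κ → K)} (hZ : A.Definable L Z)
    (h : Sum.elim (fun _ => c) b ∈ Z) : {x | Sum.elim x b ∈ Z}.Infinite := fun hfin =>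
  hc (mem_acl_of_mem_finite hfin (definable_fiber_union_range b hZ) (x := fun _ => c) h 0)

theorem range_restrict {ι : Type*} (a : ι → K) (S : Finset ι) :
    Set.range (fun j : S => a j) = a '' S := by
  ext; simp

/-- A type over `A` of an independent tuple is realized by a tuple independent over `B`. -/
theorem IsAleph1Saturated.exists_aclIndep_realization (h : IsAleph1Saturated L K)
    (hex : Exchange L K) (hB : B.Countable) (hAB : A ⊆ B) {ι : Type*} {a : ι → K}
    {S : Finset ι} (hS : AclIndep L A a S) :
    ∃ b : ι → K, AclIndep L B b S ∧ ∀ X : Set (S → K), A.Definable L X →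
      (fun j : S => a j) ∈ X → (fun j : S => b j) ∈ X := by
  classical
  induction S using Finset.induction_on with
  | empty => exact ⟨a, aclIndep_empty, fun X _ hX => hX⟩
  | insert i S hi ih =>
    obtain ⟨b, hb, htp⟩ := ih (hS.subset (Finset.subset_insert _ _))
    have hai : a i ∉ acl L (A ∪ Set.range fun j : S => a j) := fun hc => by
      refine hS i (Finset.mem_insert_self _ _) (acl_mono ?_ hc)
      rw [range_restrict]
      refine Set.union_subset_union_right _ (Set.image_mono fun k hk => ⟨?_, ?_⟩)
      · exact Finset.mem_insert_of_mem hk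
      · rintro rfl; exact hi hk
    have hinf : ∀ Z : Set (Fin 1 ⊕ S → K), A.Definable L Z →
        Sum.elim (fun _ => a i) (fun j : S => a j) ∈ Z →
        {x | Sum.elim x (fun j : S => b j) ∈ Z}.Infinite := by
      intro Z hZ haZ
      have h1 := infinite_fiber_of_notMem_acl hai hZ haZ
      -- Infinitude is the conjunction over all `N` of "at least `N` points". Each of these is an
      -- `A`-definable condition on the base point, so it passes from `a` to `b`.
      rw [← Set.encard_eq_top_iff, ENat.eq_top_iff_forall_ge]
      intro N
      refine htp _ (definable_le_encard_fiber hZ N) ?_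
      rw [Set.mem_ofPred_eq, Set.encard_eq_top_iff.2 h1]
      exact le_top
    let C : Set K := B ∪ Set.range fun j : S => b j
    have hC : C.Countable := hB.union (Set.countable_range _)
    let 𝓕₁ : Set (Set (Fin 1 → K)) := {Y | ∃ Z : Set (Fin 1 ⊕ S → K), A.Definable L Z ∧
      Sum.elim (fun _ => a i) (fun j : S => a j) ∈ Z ∧
      Y = {x | Sum.elim x (fun j : S => b j) ∈ Z}}
    let 𝓕₂ : Set (Set (Fin 1 → K)) := {Y | C.Definable L Y ∧ Yᶜ.Finite}
    obtain ⟨c, hc⟩ := h.sInter_nonempty hC (𝓕 := 𝓕₁ ∪ 𝓕₂) (by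
      rintro Y (⟨Z, hZ, -, rfl⟩ | hY)
      · exact definable_fiber_union_range _ (hZ.mono hAB)
      · exact hY.1) fun 𝓖 h𝓖 hf => by
      -- A finite intersection of the required sets contains one infinite fibre minus a finite set,
      -- hence is nonempty.
      have key : ∃ Z : Set (Fin 1 ⊕ S → K), A.Definable L Z ∧
          Sum.elim (fun _ => a i) (fun j : S => a j) ∈ Z ∧
          ∃ F : Set (Fin 1 → K), F.Finite ∧
            {x | Sum.elim x (fun j : S => b j) ∈ Z} \ F ⊆ ⋂₀ 𝓖 := by
        clear hC
        induction 𝓖, hf using Set.Finite.induction_on with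
        | empty => exact ⟨Set.univ, Set.definable_univ, trivial, ∅, Set.finite_empty, by simp⟩
        | @insert Y 𝓖 _ _ ih =>
          obtain ⟨Z, hZ, haZ, F, hF, hsub⟩ := ih ((Set.subset_insert _ _).trans h𝓖)
          rw [Set.sInter_insert]
          rcases h𝓖 (Set.mem_insert _ _) with ⟨Z', hZ', haZ', rfl⟩ | hY
          · exact ⟨Z' ∩ Z, hZ'.inter hZ, ⟨haZ', haZ⟩, F, hF,
              fun x hx => ⟨hx.1.1, hsub ⟨hx.1.2, hx.2⟩⟩⟩
          · refine ⟨Z, hZ, haZ, Yᶜ ∪ F, hY.2.union hF, fun x hx => ⟨?_, ?_⟩⟩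
            · by_contra hxY
              exact hx.2 (Or.inl hxY)
            · exact hsub ⟨hx.1, fun hxF => hx.2 (Or.inr hxF)⟩
      obtain ⟨Z, hZ, haZ, F, hF, hsub⟩ := key
      exact ((hinf Z hZ haZ).sdiff hF).nonempty.mono hsub
    have hupd : ∀ j ∈ S, b j = Function.update b i (c 0) j := fun j hj => by
      rw [Function.update_of_ne]
      rintro rfl
      exact hi hj
    have hupd' : (fun j : S => Function.update b i (c 0) j) = fun j : S => b j :=
      funext fun j => (hupd j j.2).symm
    refine ⟨Function.update b i (c 0), (hb.congr hupd).insert hex fun hcon => ?_,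
      fun X hX haX => ?_⟩
    · rw [← range_restrict, hupd', Function.update_self] at hcon
      obtain ⟨s, hs, hd, hcs⟩ := hcon
      refine hc {x : Fin 1 → K | x 0 ∈ s}ᶜ (Or.inr ⟨hd.compl, ?_⟩) hcs
      rw [compl_compl]
      refine (Set.Finite.pi' fun _ : Fin 1 => hs).subset fun x hx k => ?_
      rw [Subsingleton.elim k 0]
      exact hx
    · obtain ⟨e, he⟩ := sumElim_comp_insert (K := K) (i := i) (S := S)
      have := hc _ (Or.inl ⟨_, hX.preimage_comp e, by simpa [he] using haX, rfl⟩)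
      have hce : Sum.elim c (fun j : S => b j) ∘ e
          = fun j : ↥(insert i S) => Function.update b i (c 0) j := by
        rw [← he, hupd', Function.update_self]
        congr 2
        funext k
        rw [Subsingleton.elim k 0]
      rw [← hce]
      exact this

/-- A point of an `A`-definable set can be moved within the set without lowering its dimension when
the parameters grow. -/
theorem IsAleph1Saturated.exists_le_dim (h : IsAleph1Saturated L K) (hex : Exchange L K)
    (hB : B.Countable) (hAB : A ⊆ B) {ι : Type*} [Finite ι] {X : Set (ι → K)}
    (hX : A.Definable L X) {a : ι → K} (ha : a ∈ X) : ∃ b ∈ X, dim L A a ≤ dim L B b := by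
  obtain ⟨S, hS, -, hd⟩ := exists_basis (L := L) hex A a
  obtain ⟨b, hb, htp⟩ := h.exists_aclIndep_realization hex hB hAB hS
  -- The projection of `X` to the basis coordinates is `A`-definable and contains the restriction of
  -- `a`; it therefore contains that of `b`, which lifts to `X`.
  obtain ⟨x, hx, hxb⟩ := htp _ (hX.image_comp (fun j : S => (j : ι))) ⟨a, ha, rfl⟩
  exact ⟨x, hx, hd ▸ (hb.congr fun i hi => (congrFun hxb ⟨i, hi⟩).symm).card_le_dim hex⟩

end Saturation

/-! ### Exchange and uniqueness of the generic type. -/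

section StronglyMinimal

variable {L : FirstOrder.Language.{u, v}} {M : Type w} [L.Structure M] {A : Set M}

/-- A double count. If the set of possible `b` over `c` were cofinite, infinitely many `c'` would
have an equally small exceptional set; any `N + 1` of them would share a common `y`, whose fibre has
at most `N` points. -/
theorem IsStronglyMinimal.finite_or_compl_finite (h : IsStronglyMinimal L M) {X : Set (Fin 1 → M)}
    (hX : A.Definable L X) : X.Finite ∨ Xᶜ.Finite := by
  let e : (Fin 1 → M) ≃ M := Equiv.funUnique (Fin 1) M
  have he : ∀ Y : Set (Fin 1 → M), (e.symm ⁻¹' Y).Finite → Y.Finite := fun Y hY => by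
    simpa using (hY.preimage e.injective.injOn)
  have h1 : {x : Fin 1 → M | x 0 ∈ e.symm ⁻¹' X} = X := by
    ext x
    exact iff_of_eq (congrArg (· ∈ X) (e.symm_apply_apply x))
  refine (h.2 M ⟨FirstOrder.Language.ElementaryEmbedding.refl L M⟩ (e.symm ⁻¹' X) ?_).imp
    (he X) (fun h' => he Xᶜ (by rwa [Set.preimage_compl]))
  rw [Set.Definable₁, h1]
  exact hX.mono (Set.subset_univ _)

theorem IsStronglyMinimal.exchange (h : IsStronglyMinimal L M) : Exchange L M := by
  intro A b c hc hcA
  have := h.1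
  rw [← Set.range_const (ι := Fin 1) (c := b)] at hc
  obtain ⟨s, hs, hd, hcs⟩ := hc
  obtain ⟨Z, hZ, hsZ⟩ := exists_definable_of_definable_union_range hd
  have hfin : {x | Sum.elim x (fun _ : Fin 1 => b) ∈ Z}.Finite := by
    refine Set.Finite.subset (Set.Finite.pi' fun _ : Fin 1 => hs) fun x hx i => ?_
    rw [Subsingleton.elim i 0]
    exact (hsZ x).2 hx
  obtain ⟨N, hN⟩ := hfin.exists_encard_eq_coe
  let W : Set (Fin 1 ⊕ Fin 1 → M) := (fun w => w ∘ Sum.swap) ⁻¹' Z ∩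
    (fun w => w ∘ Sum.inl) ⁻¹' {y | {x | Sum.elim x y ∈ Z}.encard ≤ N}
  have hW : A.Definable L W :=
    (hZ.preimage_comp _).inter ((definable_encard_fiber_le hZ N).preimage_comp _)
  have hWi : ∀ x y : Fin 1 → M, Sum.elim y x ∈ W ↔
      Sum.elim x y ∈ Z ∧ {x | Sum.elim x y ∈ Z}.encard ≤ N := fun x y => by
    have : Sum.elim y x ∘ Sum.swap = Sum.elim x y := by
      funext j; rcases j with j | j <;> rfl
    simp [W, this]
  have hbW : Sum.elim (fun _ => b) (fun _ => c) ∈ W := (hWi _ _).2 ⟨(hsZ _).1 hcs, hN.le⟩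
  have hWd : (A ∪ {c}).Definable L {y | Sum.elim y (fun _ : Fin 1 => c) ∈ W} :=
    (definable_fiber_union_range _ hW).mono (by simp)
  rcases h.finite_or_compl_finite hWd with hf | hf
  · exact mem_acl_of_mem_finite hf hWd (x := fun _ => b) hbW 0
  exfalso
  obtain ⟨k, hk⟩ := hf.exists_encard_eq_coe
  let V : Set (Fin 1 → M) := {x | {y | Sum.elim y x ∈ Wᶜ}.encard ≤ k}
  have hV : A.Definable L V := definable_encard_fiber_le hW.compl k
  have hVinf : V.Infinite := fun hVf =>
    hcA (mem_acl_of_mem_finite hVf hV (x := fun _ => c) hk.le 0)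
  obtain ⟨t, htV, ht⟩ := hVinf.exists_subset_card_eq (N + 1)
  have hne : (⋃ x ∈ t, {y : Fin 1 → M | Sum.elim y x ∈ Wᶜ}).Finite :=
    t.finite_toSet.biUnion fun x hx => Set.finite_of_encard_le_coe (htV hx)
  obtain ⟨y, hy⟩ := hne.exists_notMem
  simp only [Set.mem_iUnion, not_exists] at hy
  have hy' : ∀ x ∈ t, Sum.elim y x ∈ W := fun x hx => by
    by_contra hc
    exact hy x hx hc
  have hsub : (t : Set (Fin 1 → M)) ⊆ {x | Sum.elim x y ∈ Z} := fun x hx =>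
    ((hWi _ _).1 (hy' x hx)).1
  obtain ⟨x, hx⟩ : t.Nonempty := Finset.card_pos.1 (by omega)
  have h1 := (Set.encard_le_encard hsub).trans ((hWi _ _).1 (hy' x hx)).2
  rw [Set.encard_coe_eq_coe_finsetCard, ht] at h1
  norm_cast at h1
  omega

/-- In a strongly minimal structure, independent tuples over `A` have the same type over `A`. -/
theorem IsStronglyMinimal.mem_of_aclIndep (h : IsStronglyMinimal L M) {ι : Type*} {a b : ι → M}
    {S : Finset ι} (ha : AclIndep L A a S) (hb : AclIndep L A b S) {X : Set (S → M)}
    (hX : A.Definable L X) (haX : (fun j : S => a j) ∈ X) : (fun j : S => b j) ∈ X := by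
  classical
  induction S using Finset.induction_on with
  | empty =>
    convert haX using 2 with j
    exact absurd j.2 (Finset.notMem_empty _)
  | insert i S hi ih =>
    have hni : ∀ a : ι → M, AclIndep L A a (insert i S) →
        a i ∉ acl L (A ∪ Set.range fun j : S => a j) := fun a ha hc => by
      refine ha i (Finset.mem_insert_self _ _) (acl_mono ?_ hc)
      rw [range_restrict]
      refine Set.union_subset_union_right _ (Set.image_mono fun k hk => ⟨?_, ?_⟩)
      · exact Finset.mem_insert_of_mem hk
      · rintro rfl; exact hi hk
    obtain ⟨e, he⟩ := sumElim_comp_insert (K := M) (i := i) (S := S)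
    have hZ := hX.preimage_comp e
    set Z := (fun g : Fin 1 ⊕ S → M => g ∘ e) ⁻¹' X with hZdef
    have hmem : ∀ a : ι → M, Sum.elim (fun _ : Fin 1 => a i) (fun j : S => a j) ∈ Z ↔
        (fun j : ↥(insert i S) => a j) ∈ X := fun a => by
      rw [hZdef, Set.mem_preimage, he]
    have hinf := infinite_fiber_of_notMem_acl (hni a ha) hZ ((hmem a).2 haX)
    have hd : (A ∪ Set.range fun j : S => a j).Definable L
        {x | Sum.elim x (fun j : S => a j) ∈ Z} :=
      definable_fiber_union_range _ hZ
    -- The fibre over `a` is infinite, hence cofinite. The size bound on its complement is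
    -- `A`-definable, so induction carries it over to `b`, and the new coordinate of `b` avoids
    -- every finite fibre.
    obtain ⟨k, hk⟩ := ((h.finite_or_compl_finite hd).resolve_left hinf).exists_encard_eq_coe
    have hbk := ih (ha.subset (Finset.subset_insert _ _)) (hb.subset (Finset.subset_insert _ _))
      (definable_encard_fiber_le hZ.compl k) hk.le
    by_contra hbX
    exact infinite_fiber_of_notMem_acl (hni b hb) hZ.compl (fun hc => hbX ((hmem b).1 hc))
      (Set.finite_of_encard_le_coe hbk)

end StronglyMinimal

/-! ### Dimension of tuples of tuples. -/

section Tuples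

variable {L : FirstOrder.Language.{u, v}} {K : Type w} [L.Structure K] {A B : Set K}
  {ι δ σ : Type*}

theorem AclIndep.restrict {a : ι → K} {S : Finset ι} (h : AclIndep L A a S) :
    AclIndep L A (fun j : S => a j) Finset.univ := by
  intro i _ hc
  refine h i i.2 (acl_mono (Set.union_subset_union_right _ ?_) hc)
  rintro _ ⟨j, ⟨-, hj⟩, rfl⟩
  exact ⟨j, ⟨j.2, fun h => hj (Subtype.ext h)⟩, rfl⟩

theorem aclIndep_univ_of_card_le_dim [Fintype ι] (hex : Exchange L K) {a : ι → K}
    (h : Fintype.card ι ≤ dim L A a) : AclIndep L A a Finset.univ := by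
  obtain ⟨S, hS, -, hd⟩ := exists_basis (L := L) hex A a
  rwa [← Finset.eq_univ_of_card S (le_antisymm S.card_le_univ (hd ▸ h))]

theorem dim_insert_le [DecidableEq ι] [Finite δ] (hex : Exchange L K) (A : Set K)
    (f : ι → δ → K) (i : ι) (S : Finset ι) :
    dim L A (fun p : ↥(insert i S) × δ => f p.1 p.2) ≤
      dim L (A ∪ Set.range fun p : S × δ => f p.1 p.2) (f i) +
        dim L A (fun p : S × δ => f p.1 p.2) := by
  rw [← dim_sumElim hex]
  refine dim_le_of_range_subset hex ?_
  rintro _ ⟨⟨⟨j, hj⟩, k⟩, rfl⟩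
  rcases Finset.mem_insert.1 hj with rfl | hj
  · exact ⟨Sum.inl k, rfl⟩
  · exact ⟨Sum.inr (⟨j, hj⟩, k), rfl⟩

theorem dim_le_sum [Finite δ] (hex : Exchange L K) (A : Set K) (f : ι → δ → K) (S : Finset ι) :
    dim L A (fun p : S × δ => f p.1 p.2) ≤ ∑ i ∈ S, dim L A (f i) := by
  classical
  induction S using Finset.induction_on with
  | empty =>
    rw [Finset.sum_empty, Nat.le_zero, dim_eq_zero_iff hex]
    rintro ⟨⟨i, hi⟩, -⟩
    exact absurd hi (Finset.notMem_empty _)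
  | insert i S hi ih =>
    rw [Finset.sum_insert hi]
    exact (dim_insert_le hex A f i S).trans
      (add_le_add (dim_anti hex _ Set.subset_union_left) ih)

end Tuples

theorem IsStronglyMinimal.mem_of_aclIndep_univ {L : FirstOrder.Language.{u, v}} {M : Type w}
    [L.Structure M] {A : Set M} (h : IsStronglyMinimal L M) {ι : Type*} [Fintype ι] {a b : ι → M}
    (ha : AclIndep L A a Finset.univ) (hb : AclIndep L A b Finset.univ) {X : Set (ι → M)}
    (hX : A.Definable L X) (haX : a ∈ X) : b ∈ X :=
  h.mem_of_aclIndep (S := Finset.univ) ha hb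
    (hX.preimage_comp fun i => (⟨i, Finset.mem_univ i⟩ : (Finset.univ : Finset ι))) haX

/-! ### Comparing `M`-rank with `K`-dimension. -/

section Relics

variable {K : Type w} {d : ℕ} {M : Set (Fin d → K)} {ι κ : Type*}

theorem flat_injective : Function.Injective (flat : (ι → M) → ι × Fin d → K) := fun x y h => by
  funext i
  exact Subtype.ext (funext fun j => congrFun h (i, j))

theorem coords_union (A B : Set M) : coords (A ∪ B) = coords A ∪ coords B := by
  ext k
  simp only [coords, Set.mem_union, Set.mem_ofPred_eq, or_and_right, exists_or]

theorem coords_countable {A : Set M} (hA : A.Countable) : (coords A).Countable := by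
  have : coords A = ⋃ a ∈ A, Set.range (a : Fin d → K) := by
    ext k; simp [coords]
  rw [this]
  exact hA.biUnion fun a _ => Set.countable_range _

theorem coords_image (a : ι → M) (S : Finset ι) :
    coords (a '' S) = Set.range fun p : S × Fin d => (a p.1 : Fin d → K) p.2 := by
  ext k
  simp only [coords, Set.mem_ofPred_eq, Set.mem_range, Prod.exists, Set.mem_image]
  constructor
  · rintro ⟨_, ⟨i, hi, rfl⟩, j, rfl⟩
    exact ⟨⟨i, hi⟩, j, rfl⟩
  · rintro ⟨⟨i, hi⟩, j, rfl⟩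
    exact ⟨_, ⟨i, hi, rfl⟩, j, rfl⟩

variable {L : FirstOrder.Language.{u, v}} [L.Structure K] {L' : FirstOrder.Language.{u', v'}}
  [L'.Structure M] {P : Set K} {A : Set M}

theorem IsRelic.definable_flat_image_of_empty (h : IsRelic L L' P M) [Finite ι]
    {X : Set (ι → M)} (hX : (∅ : Set M).Definable L' X) : P.Definable L (flat '' X) := by
  obtain ⟨n, ⟨e⟩⟩ := Finite.exists_equiv_fin ι
  have h1 := (h n _ (hX.preimage_comp e)).preimage_comp fun p : Fin n × Fin d => (e.symm p.1, p.2)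
  refine (congrArg (P.Definable L) (Set.ext fun x => ?_)).mp h1
  constructor
  · rintro ⟨y, hy, hyx⟩
    refine ⟨y ∘ e, hy, funext fun p => ?_⟩
    have := congrFun hyx (e p.1, p.2)
    simpa [flat] using this
  · rintro ⟨y, hy, rfl⟩
    refine ⟨y ∘ e.symm, ?_, rfl⟩
    simpa [Function.comp_assoc] using hy

theorem IsRelic.definable_flat_image (h : IsRelic L L' P M) [Finite ι] {X : Set (ι → M)}
    (hX : A.Definable L' X) : (P ∪ coords A).Definable L (flat '' X) := by
  obtain ⟨A0, hA0, hX⟩ := Set.definable_iff_finitely_definable.1 hX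
  let b : A0 → M := Subtype.val
  obtain ⟨Z, hZ, hXZ⟩ := exists_definable_of_definable_union_range (A := (∅ : Set M)) (b := b)
    (hX.mono (by simp [b]))
  -- `g` separates the `K`-coordinates of the variables from those of the parameters, so that the
  -- latter can be specialized.
  let g : (ι ⊕ A0) × Fin d → (ι × Fin d) ⊕ (A0 × Fin d) := fun p =>
    p.1.elim (fun i => Sum.inl (i, p.2)) fun k => Sum.inr (k, p.2)
  have h1 := definable_fiber (A := P ∪ coords A) (b := flat b)
    (fun p => Or.inr ⟨p.1, hA0 p.1.2, p.2, rfl⟩)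
    (((h.definable_flat_image_of_empty hZ).mono Set.subset_union_left).preimage_comp g)
  refine (congrArg ((P ∪ coords A).Definable L) (Set.ext fun x => ?_)).mp h1
  constructor
  · rintro ⟨z, hz, hzx⟩
    have hx : flat (z ∘ Sum.inl) = x := funext fun p => congrFun hzx (Sum.inl p.1, p.2)
    have hb : z ∘ Sum.inr = b := flat_injective (funext fun p => congrFun hzx (Sum.inr p.1, p.2))
    refine ⟨z ∘ Sum.inl, (hXZ _).2 ?_, hx⟩
    rwa [← hb, Sum.elim_comp_inl_inr]
  · rintro ⟨y, hy, rfl⟩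
    refine ⟨Sum.elim y b, (hXZ y).1 hy, funext fun p => ?_⟩
    rcases p with ⟨i | k, j⟩ <;> rfl

theorem IsRelic.definable_carrier (h : IsRelic L L' P M) : P.Definable L M := by
  have h1 := (h.definable_flat_image_of_empty (ι := Fin 1) Set.definable_univ).image_comp
    fun j : Fin d => ((0 : Fin 1), j)
  refine (congrArg (P.Definable L) (Set.ext fun x => ?_)).mp h1
  constructor
  · rintro ⟨_, ⟨y, -, rfl⟩, rfl⟩
    exact (y 0).2
  · intro hx
    exact ⟨_, ⟨fun _ => ⟨x, hx⟩, trivial, rfl⟩, rfl⟩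

/-- Compactness for `M` is borrowed from the saturation of `K`: flattened `M(A)`-definable sets are
definable in `K` over the countable set `P ∪ coords A`. -/
theorem IsRelic.exists_finite_cover (h : IsRelic L L' P M) (hsat : IsAleph1Saturated L K)
    (hP : P.Countable) (hA : A.Countable) [Finite ι] {X : Set (ι → M)} (hX : A.Definable L' X)
    {𝓕 : Set (Set (ι → M))} (hd : ∀ Y ∈ 𝓕, A.Definable L' Y) (hc : X ⊆ ⋃₀ 𝓕) :
    ∃ 𝓖 ⊆ 𝓕, 𝓖.Finite ∧ X ⊆ ⋃₀ 𝓖 := by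
  obtain ⟨𝓖, h𝓖, hf, hcov⟩ := hsat.exists_finite_cover (hP.union (coords_countable hA))
    (h.definable_flat_image hX) (𝓕 := (fun Y => flat '' Y) '' 𝓕)
    (by rintro _ ⟨Y, hY, rfl⟩; exact h.definable_flat_image (hd Y hY)) (by
      rintro _ ⟨x, hx, rfl⟩
      obtain ⟨Y, hY, hxY⟩ := hc hx
      exact ⟨_, ⟨Y, hY, rfl⟩, ⟨x, hxY, rfl⟩⟩)
  refine ⟨𝓕 ∩ (fun Y => flat '' Y) ⁻¹' 𝓖, Set.inter_subset_left,
    (hf.preimage flat_injective.image_injective.injOn).subset Set.inter_subset_right,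
    fun x hx => ?_⟩
  obtain ⟨_, hZ, hxZ⟩ := hcov ⟨x, hx, rfl⟩
  obtain ⟨Y, hY, rfl⟩ := h𝓖 hZ
  exact ⟨Y, ⟨hY, hZ⟩, (flat_injective.mem_set_image).1 hxZ⟩

theorem IsRelic.coord_mem_acl (h : IsRelic L L' P M) {a : M} (ha : a ∈ acl L' A) (j : Fin d) :
    (a : Fin d → K) j ∈ acl L (P ∪ coords A) := by
  obtain ⟨s, hs, hd, has⟩ := ha
  have hf : {x : Fin 1 → M | x 0 ∈ s}.Finite := by
    refine (Set.Finite.pi' fun _ : Fin 1 => hs).subset fun x hx i => ?_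
    rw [Subsingleton.elim i 0]
    exact hx
  exact mem_acl_of_mem_finite (hf.image _) (h.definable_flat_image hd)
    (x := flat fun _ : Fin 1 => a) ⟨_, has, rfl⟩ (0, j)

variable {a : ι → M} {S : Finset ι}

theorem IsRelic.flat_mem_acl (h : IsRelic L L' P M) (hS : ∀ i, a i ∈ acl L' (A ∪ a '' S))
    (p : ι × Fin d) : flat a p ∈
      acl L (P ∪ coords A ∪ Set.range fun p : S × Fin d => (a p.1 : Fin d → K) p.2) := by
  rw [← coords_image, Set.union_assoc, ← coords_union]
  exact h.coord_mem_acl (hS p.1) p.2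

theorem IsRelic.dim_flat_le_dim_restrict (h : IsRelic L L' P M) (hex : Exchange L K) [Finite ι]
    (hS : ∀ i, a i ∈ acl L' (A ∪ a '' S)) : dim L (P ∪ coords A) (flat a) ≤
      dim L (P ∪ coords A) fun p : S × Fin d => (a p.1 : Fin d → K) p.2 :=
  dim_le_of_forall_mem_acl hex (h.flat_mem_acl hS)

theorem dim_coord_le (hex : Exchange L K) {B : Set K} (hPB : P ⊆ B) (x : M) :
    dim L B (x : Fin d → K) ≤ dimSet L P M :=
  (dim_anti hex _ hPB).trans (dim_le_dimSet hex x.2)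

theorem IsRelic.dim_flat_le_sum (h : IsRelic L L' P M) (hex : Exchange L K) [Finite ι]
    (hS : ∀ i, a i ∈ acl L' (A ∪ a '' S)) :
    dim L (P ∪ coords A) (flat a) ≤ ∑ i ∈ S, dim L (P ∪ coords A) (a i : Fin d → K) :=
  (h.dim_flat_le_dim_restrict hex hS).trans (dim_le_sum hex _ (fun i => (a i : Fin d → K)) S)

theorem IsRelic.dim_flat_le (h : IsRelic L L' P M) (hex : Exchange L K) [Finite ι]
    (hS : ∀ i, a i ∈ acl L' (A ∪ a '' S)) :
    dim L (P ∪ coords A) (flat a) ≤ S.card * dimSet L P M :=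
  (h.dim_flat_le_sum hex hS).trans
    (Finset.sum_le_card_nsmul _ _ _ fun _ _ => dim_coord_le hex Set.subset_union_left _)

theorem IsRelic.dimSet_pos (h : IsRelic L L' P M) (hex : Exchange L K)
    (hsat : IsAleph1Saturated L K) (hP : P.Countable) (hM : Infinite M) : 0 < dimSet L P M := by
  obtain ⟨x, hx, i, hi⟩ := hsat.exists_notMem_acl hP h.definable_carrier (Set.infinite_coe_iff.1 hM)
  refine lt_of_lt_of_le (Nat.pos_of_ne_zero fun h0 => ?_) (dim_le_dimSet hex hx)
  exact hi ((dim_eq_zero_iff hex).1 h0 i)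

/-- Generic points of the powers of `M` exist over all countable sets of parameters. -/
theorem IsRelic.exists_le_dim_flat (h : IsRelic L L' P M) (hex : Exchange L K)
    (hsat : IsAleph1Saturated L K) (hM : Nonempty M) {B : Set K} (hB : B.Countable)
    (hPB : P ⊆ B) (ι : Type*) [Fintype ι] :
    ∃ a : ι → M, Fintype.card ι * dimSet L P M ≤ dim L B (flat a) := by
  have key : ∀ n : ℕ, ∃ a : Fin n → M, n * dimSet L P M ≤ dim L B (flat a) := by
    intro n
    induction n with
    | zero => exact ⟨Fin.elim0, by simp⟩
    | succ n ih =>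
      obtain ⟨a, ha⟩ := ih
      obtain ⟨x, hx, hxd⟩ := exists_dim_eq_dimSet (A := P) hex (Set.nonempty_coe_sort.1 hM)
      obtain ⟨y, hy, hyd⟩ := hsat.exists_le_dim hex (B := B ∪ Set.range (flat a))
        (hB.union (Set.countable_range _)) (hPB.trans Set.subset_union_left)
        h.definable_carrier hx
      refine ⟨Fin.cons ⟨y, hy⟩ a, ?_⟩
      have h1 : dim L B (Sum.elim y (flat a)) ≤
          dim L B (flat (Fin.cons ⟨y, hy⟩ a : Fin (n + 1) → M)) := by
        refine dim_le_of_range_subset hex ?_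
        rintro _ ⟨j | p, rfl⟩
        · exact ⟨(0, j), rfl⟩
        · exact ⟨(p.1.succ, p.2), rfl⟩
      rw [dim_sumElim hex] at h1
      rw [Nat.succ_mul]
      omega
  obtain ⟨a, ha⟩ := key (Fintype.card ι)
  refine ⟨a ∘ Fintype.equivFin ι, ha.trans (dim_le_of_range_subset hex ?_)⟩
  rintro _ ⟨p, rfl⟩
  exact ⟨((Fintype.equivFin ι).symm p.1, p.2), by simp [flat]⟩

/-- A tuple from `M` of maximal dimension in the sense of `K` is independent in the sense of the
relic. -/
theorem IsRelic.aclIndep_univ_of_le_dim_flat (h : IsRelic L L' P M) (hex : Exchange L K)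
    (hex' : Exchange L' M) (hD : 0 < dimSet L P M) [Fintype ι]
    (ha : Fintype.card ι * dimSet L P M ≤ dim L (P ∪ coords A) (flat a)) :
    AclIndep L' A a Finset.univ := by
  refine aclIndep_univ_of_card_le_dim hex' ?_
  obtain ⟨S, -, hS, hd⟩ := exists_basis (L := L') hex' A a
  exact hd ▸ Nat.le_of_mul_le_mul_right (ha.trans (h.dim_flat_le hex hS)) hD

/-- A `K`-generic point of the power of `M` is `M`-independent over `A`, hence has the same type as
`a` and also lies in `X`. -/
theorem IsRelic.le_dimSet_flat_image (h : IsRelic L L' P M) (hex : Exchange L K)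
    (hsat : IsAleph1Saturated L K) (hP : P.Countable) (hSM : IsStronglyMinimal L' M)
    (hA : A.Countable) [Fintype ι] {X : Set (ι → M)} (hX : A.Definable L' X) (haX : a ∈ X)
    (ha : AclIndep L' A a Finset.univ) :
    Fintype.card ι * dimSet L P M ≤ dimSet L (P ∪ coords A) (flat '' X) := by
  have := hSM.1
  obtain ⟨b, hb⟩ := h.exists_le_dim_flat hex hsat inferInstance
    (hP.union (coords_countable hA)) Set.subset_union_left ι
  have hb' := h.aclIndep_univ_of_le_dim_flat hex hSM.exchange
    (h.dimSet_pos hex hsat hP hSM.1) hb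
  exact hb.trans (dim_le_dimSet hex ⟨b, hSM.mem_of_aclIndep_univ ha hb' hX haX, rfl⟩)

/-- If the points of `G` are algebraic over their coordinates in `S`, and `S` is independent on `G`
in the sense of the relic, then generic points of `G` in the sense of `K` are generic on `S`. -/
theorem IsRelic.le_dim_flat_of_generic (h : IsRelic L L' P M) (hex : Exchange L K)
    (hsat : IsAleph1Saturated L K) (hP : P.Countable) (hSM : IsStronglyMinimal L' M)
    (hA : A.Countable) [Finite ι] {G : Set (ι → M)} (hG : A.Definable L' G) (haG : a ∈ G)
    (ha : AclIndep L' A a S) {x : ι → M} (hx : KGeneric L P A G x) :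
    S.card * dimSet L P M ≤ dim L (P ∪ coords A) (flat x) := by
  have h1 := h.le_dimSet_flat_image hex hsat hP hSM hA
    (hG.image_comp fun j : S => (j : ι)) ⟨a, haG, rfl⟩ ha.restrict
  rw [Fintype.card_coe] at h1
  refine h1.trans (dimSet_le ?_)
  rintro _ ⟨_, ⟨y, hy, rfl⟩, rfl⟩
  rw [hx.2]
  refine le_trans ?_ (dim_le_dimSet hex ⟨y, hy, rfl⟩)
  refine dim_le_of_range_subset hex ?_
  rintro _ ⟨p, rfl⟩
  exact ⟨(p.1, p.2), rfl⟩

/-- Each of the `|S|` basis elements contributes at most `dim M`. When the total is `|S| · dim M`,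
none can contribute less, so `a i` keeps full dimension over all the others and in particular over
`a j`. -/
theorem IsRelic.indep_coords (h : IsRelic L L' P M) (hex : Exchange L K) [Finite ι]
    (hS : ∀ i, a i ∈ acl L' (A ∪ a '' S))
    (ha : S.card * dimSet L P M ≤ dim L (P ∪ coords A) (flat a)) {i j : ι} (hi : i ∈ S)
    (hj : j ∈ S) (hij : i ≠ j) :
    Indep L (P ∪ coords A) (a i : Fin d → K) (a j : Fin d → K) := by
  classical
  refine le_antisymm (dim_anti hex _ Set.subset_union_left) ?_
  have h1 := ha.trans (h.dim_flat_le_dim_restrict hex hS)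
  have h2 := dim_insert_le (L := L) hex (P ∪ coords A) (fun i => (a i : Fin d → K)) i (S.erase i)
  rw [Finset.insert_erase hi] at h2
  have h3 : dim L (P ∪ coords A) (fun p : ↥(S.erase i) × Fin d => (a p.1 : Fin d → K) p.2) ≤
      (S.erase i).card * dimSet L P M :=
    (dim_le_sum hex _ (fun i => (a i : Fin d → K)) _).trans
      (Finset.sum_le_card_nsmul _ _ _ fun _ _ => dim_coord_le hex Set.subset_union_left _)
  have h4 : S.card * dimSet L P M = (S.erase i).card * dimSet L P M + dimSet L P M := by
    rw [← Nat.succ_mul, Nat.succ_eq_add_one, Finset.card_erase_add_one hi]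
  have h5 : dim L (P ∪ coords A ∪ Set.range fun p : ↥(S.erase i) × Fin d =>
      (a p.1 : Fin d → K) p.2) (a i : Fin d → K) ≤
      dim L (P ∪ coords A ∪ Set.range (a j : Fin d → K)) (a i : Fin d → K) := by
    refine dim_anti hex _ (Set.union_subset_union_right _ ?_)
    rintro _ ⟨k, rfl⟩
    exact ⟨(⟨j, Finset.mem_erase.2 ⟨hij.symm, hj⟩⟩, k), rfl⟩
  have h6 := dim_coord_le (L := L) (P := P) hex (B := P ∪ coords A) Set.subset_union_left (a i)
  omega

/-- Subadditivity again: one coordinate of smaller dimension would push the sum below the maximum.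
This supplies the coordinatewise genericity that weak detection asks for. -/
theorem coord_generic_of_le_dim_flat (hex : Exchange L K) [Fintype ι]
    (ha : Fintype.card ι * dimSet L P M ≤ dim L (P ∪ coords A) (flat a)) (i : ι) :
    IsGeneric L P M (a i : Fin d → K) := by
  refine ⟨(a i).2, le_antisymm (dim_coord_le hex subset_rfl _) ?_⟩
  by_contra! hlt
  have h1 : dim L (P ∪ coords A) (flat a) ≤ ∑ i : ι, dim L P (a i : Fin d → K) := by
    refine (dim_anti hex _ Set.subset_union_left).trans (le_trans ?_
      (dim_le_sum hex P (fun i => (a i : Fin d → K)) Finset.univ))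
    refine dim_le_of_range_subset hex ?_
    rintro _ ⟨p, rfl⟩
    exact ⟨(⟨p.1, Finset.mem_univ _⟩, p.2), rfl⟩
  have h2 := Finset.sum_lt_sum (s := Finset.univ) (f := fun i => dim L P (a i : Fin d → K))
    (g := fun _ => dimSet L P M) (fun i _ => dim_coord_le hex subset_rfl _)
    ⟨i, Finset.mem_univ i, hlt⟩
  rw [Finset.sum_const, Finset.card_univ, smul_eq_mul] at h2
  omega

end Relics

/-! ### The frontier inequality over arbitrary finite index types. -/

section Reindexing

variable {L : FirstOrder.Language.{u, v}} {K : Type w} [L.Structure K] {A : Set K}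
  {ι κ : Type*} [Finite ι] [Finite κ]

theorem dim_comp_equiv (hex : Exchange L K) (A : Set K) (a : ι → K) (e : κ ≃ ι) :
    dim L A (a ∘ e) = dim L A a :=
  le_antisymm (dim_le_of_range_subset hex (Set.range_comp_subset_range _ _))
    (dim_le_of_range_subset hex (by rw [e.surjective.range_comp]))

theorem dimSet_preimage_comp_equiv (hex : Exchange L K) (A : Set K) (X : Set (κ → K))
    (e : κ ≃ ι) : dimSet L A ((fun g : ι → K => g ∘ e) ⁻¹' X) = dimSet L A X := by
  refine le_antisymm (dimSet_le fun x hx => ?_) (dimSet_le fun x hx => ?_)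
  · rw [← dim_comp_equiv hex A x e]
    exact dim_le_dimSet hex hx
  · rw [← dim_comp_equiv hex A x e.symm]
    refine dim_le_dimSet hex ?_
    simpa [Function.comp_assoc] using hx

theorem IsHausdorffGeometric.dim_lt_dimSet [TopologicalSpace K] (hK : IsHausdorffGeometric L K)
    (hex : Exchange L K) (hA : A.Countable) {X : Set (ι → K)} (hX : A.Definable L X) {a : ι → K}
    (ha : a ∈ closure X) (haX : a ∉ X) : dim L A a < dimSet L A X := by
  obtain ⟨n, ⟨e⟩⟩ := Finite.exists_equiv_fin ι
  have hcont : Continuous fun g : ι → K => g ∘ e.symm :=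
    continuous_pi fun i => continuous_apply _
  have hmem : ∀ x : ι → K, x ∘ e.symm ∈ (fun g : Fin n → K => g ∘ e) ⁻¹' X ↔ x ∈ X := fun x => by
    simp [Function.comp_assoc]
  have hcl : a ∘ e.symm ∈ closure ((fun g : Fin n → K => g ∘ e) ⁻¹' X) :=
    map_mem_closure (f := fun g : ι → K => g ∘ e.symm) hcont ha fun x hx => (hmem x).2 hx
  have h1 := hK.strong_frontier n A hA _ (hX.preimage_comp e) (a ∘ e.symm)
    (subset_closure ⟨hcl, fun hc => haX ((hmem a).1 hc)⟩)
  rwa [dim_comp_equiv hex, dimSet_preimage_comp_equiv hex] at h1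

end Reindexing

/-! ### Weak detection of closures over arbitrary finite index types. -/

section Relics

variable {L : FirstOrder.Language.{u, v}} {K : Type w} [L.Structure K]
  {d : ℕ} {M : Set (Fin d → K)} {L' : FirstOrder.Language.{u', v'}} [L'.Structure M] {P : Set K}
  {A : Set M} {ι κ : Type*}

theorem continuous_flat [TopologicalSpace K] : Continuous (flat : (ι → M) → ι × Fin d → K) :=
  continuous_pi fun p => (continuous_apply p.2).comp
    (continuous_subtype_val.comp (continuous_apply p.1))

theorem kGeneric_comp_equiv [Finite ι] [Finite κ] (hex : Exchange L K) {X : Set (κ → M)}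
    (e : κ ≃ ι) {y : ι → M} (hy : KGeneric L P A ((fun g : ι → M => g ∘ e) ⁻¹' X) y) :
    KGeneric L P A X (y ∘ e) := by
  have hdim : ∀ z : ι → M, dim L (P ∪ coords A) (flat (z ∘ e)) = dim L (P ∪ coords A) (flat z) :=
    fun z => dim_comp_equiv hex _ (flat z) (e.prodCongr (Equiv.refl (Fin d)))
  obtain ⟨⟨z, hz, hzy⟩, hd⟩ := hy
  obtain rfl := flat_injective hzy
  refine ⟨⟨_, hz, rfl⟩, ?_⟩
  rw [hdim, hd]
  refine le_antisymm (dimSet_le ?_) (dimSet_le ?_)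
  · rintro _ ⟨z, hz, rfl⟩
    rw [← hdim z]
    exact dim_le_dimSet hex ⟨_, hz, rfl⟩
  · rintro _ ⟨z, hz, rfl⟩
    have hz' : (z ∘ e.symm) ∘ e = z := by simp [Function.comp_assoc]
    rw [← hz', hdim]
    refine dim_le_dimSet hex ⟨_, ?_, rfl⟩
    rwa [Set.mem_preimage, hz']

theorem WeaklyDetectsClosures.of_finite [TopologicalSpace K] (hW : WeaklyDetectsClosures L L' P M)
    (hex : Exchange L K) (hex' : Exchange L' M) (hA : A.Countable) [Finite ι] {X : Set (ι → M)}
    (hX : A.Definable L' X) {x : ι → M} (hx : x ∈ closure X)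
    (hgen : ∀ i, IsGeneric L P M (x i : Fin d → K)) :
    dim L' A x ≤ dimSet L' A X ∧
      (dim L' A x < dimSet L' A X ∨ ∀ i j, i ≠ j →
        (∀ y, KGeneric L P A X y →
          Indep L (P ∪ coords A) (y i : Fin d → K) (y j : Fin d → K)) →
        Indep L' A (fun _ : Fin 1 => x i) (fun _ : Fin 1 => x j)) := by
  obtain ⟨n, ⟨e⟩⟩ := Finite.exists_equiv_fin ι
  have hcont : Continuous fun g : ι → M => g ∘ e.symm :=
    continuous_pi fun i => continuous_apply _
  have hcl : x ∘ e.symm ∈ closure ((fun g : Fin n → M => g ∘ e) ⁻¹' X) :=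
    map_mem_closure (f := fun g : ι → M => g ∘ e.symm) hcont hx fun x hx => by
      simpa [Function.comp_assoc] using hx
  obtain ⟨h1, h2⟩ := hW n A hA _ (hX.preimage_comp e) (x ∘ e.symm) hcl fun i => hgen (e.symm i)
  have hx1 := dim_comp_equiv hex' A x e.symm
  have hX1 := dimSet_preimage_comp_equiv hex' A X e
  refine ⟨hx1 ▸ hX1 ▸ h1, ?_⟩
  refine h2.imp (fun h => hx1 ▸ hX1 ▸ h) fun h i j hij hI => ?_
  have := h (e i) (e j) (e.injective.ne hij) fun y hy =>
    hI (y ∘ e) (kGeneric_comp_equiv hex e hy)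
  simp only [Function.comp_apply, Equiv.symm_apply_apply] at this
  exact this

end Relics

/-! ### Rank counting in standard families. -/

section Families

variable {L : FirstOrder.Language.{u, v}} {M : Type w} [L.Structure M] {A : Set M} {m k : ℕ}
  {T : Set (Fin m → M)} {C : Set (Fin 2 ⊕ Fin m → M)} {U : Set (Fin k → M)}
  {D : Set (Fin 2 ⊕ Fin k → M)} {x : Fin 2 → M} {t : Fin m → M} {u : Fin k → M}

theorem IsStandardFamily.dim_param_add_one_le (hC : IsStandardFamily L A T C)
    (hex : Exchange L M) (hx : Sum.elim x t ∈ C) : dim L (A ∪ Set.range x) t + 1 ≤ m :=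
  (Nat.add_le_add_right (dim_le_dimSet hex (X := {t | Sum.elim x t ∈ C}) hx) 1).trans
    (hC.point_condition x)

/-- Points of the intersection of independent generic curves are generic in the plane. -/
theorem IsStandardFamily.two_le_dim_of_mem_inter (hC : IsStandardFamily L A T C)
    (hD : IsStandardFamily L A U D) (hex : Exchange L M) (hxC : Sum.elim x t ∈ C)
    (hxD : Sum.elim x u ∈ D) (htu : m + k ≤ dim L A (Sum.elim t u)) : 2 ≤ dim L A x := by
  have h1 := hC.dim_param_add_one_le hex hxC
  have h2 := hD.dim_param_add_one_le hex hxD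
  have h3 : dim L A (Sum.elim t u) ≤ dim L A (Sum.elim t (Sum.elim u x)) := by
    refine dim_le_of_range_subset hex ?_
    rintro _ ⟨i | j, rfl⟩
    · exact ⟨Sum.inl i, rfl⟩
    · exact ⟨Sum.inr (Sum.inl j), rfl⟩
  rw [dim_sumElim hex A t (Sum.elim u x), dim_sumElim hex A u x] at h3
  have h4 : dim L (A ∪ Set.range (Sum.elim u x)) t ≤ dim L (A ∪ Set.range x) t := by
    refine dim_anti hex _ (Set.union_subset_union_right _ ?_)
    rintro _ ⟨i, rfl⟩
    exact ⟨Sum.inr i, rfl⟩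
  -- The count is `m + k ≤ rk(t/x) + rk(u/x) + rk(x) ≤ (m - 1) + (k - 1) + rk(x)`, all over `A`.
  omega

/-- Points of the intersection of independent generic curves are algebraic over the parameters. -/
theorem IsStandardFamily.mem_acl_of_mem_inter (hC : IsStandardFamily L A T C)
    (hD : IsStandardFamily L A U D) (hex : Exchange L M) (hxC : Sum.elim x t ∈ C)
    (hxD : Sum.elim x u ∈ D) (htu : m + k ≤ dim L A (Sum.elim t u)) (i : Fin 2) :
    x i ∈ acl L (A ∪ Set.range (Sum.elim t u)) := by
  have h1 := hD.dim_param_add_one_le hex hxD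
  have h2 : dim L (A ∪ Set.range t) x ≤ 1 := by
    rw [← hC.plane_curve t (hC.subset x t hxC)]
    exact dim_le_dimSet hex hxC
  have h3 : dim L A (Sum.elim t u) = dim L A (Sum.elim u t) :=
    le_antisymm
      (dim_le_of_range_subset hex (by rw [Set.Sum.elim_range, Set.Sum.elim_range, Set.union_comm]))
      (dim_le_of_range_subset hex (by rw [Set.Sum.elim_range, Set.Sum.elim_range, Set.union_comm]))
  rw [h3, dim_sumElim hex] at htu
  have h4 := dim_le_card (L := L) hex A t
  rw [Fintype.card_fin] at h4
  have h5 := dim_sumElim (L := L) hex (A ∪ Set.range t) x u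
  have h6 := dim_sumElim (L := L) hex (A ∪ Set.range t) u x
  have h7 : dim L (A ∪ Set.range t) (Sum.elim x u) ≤ dim L (A ∪ Set.range t) (Sum.elim u x) :=
    dim_le_of_range_subset hex (by rw [Set.Sum.elim_range, Set.Sum.elim_range, Set.union_comm])
  have h8 : dim L (A ∪ Set.range t ∪ Set.range x) u ≤ dim L (A ∪ Set.range x) u :=
    dim_anti hex _ (Set.union_subset_union_left _ Set.subset_union_left)
  -- Over `A ∪ t` the pair `(x, u)` has rank at most `1 + (k - 1)`, while `u` alone already has rank
  -- `k`; nothing is left for `x` over `t, u`.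
  have h9 : dim L (A ∪ Set.range t ∪ Set.range u) x = 0 := by omega
  rw [Set.Sum.elim_range, ← Set.union_assoc]
  exact (dim_eq_zero_iff hex).1 h9 i

end Families

theorem notMem_acl_of_card_le_dim {L : FirstOrder.Language.{u, v}} {K : Type w} [L.Structure K]
    {A : Set K} {ι : Type*} [Fintype ι] (hex : Exchange L K) {a : ι → K}
    (h : Fintype.card ι ≤ dim L A a) (i : ι) : a i ∉ acl L A := fun hc =>
  aclIndep_univ_of_card_le_dim hex h i (Finset.mem_univ i) (acl_mono Set.subset_union_left hc)

/-! ### Excluding limits of interalgebraic pairs. -/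

section Main

variable {L : FirstOrder.Language.{u, v}} {K : Type w} [L.Structure K]
  {d : ℕ} {M : Set (Fin d → K)} {L' : FirstOrder.Language.{u', v'}} [L'.Structure M] {P : Set K}
  {A : Set M}

theorem IsRelic.le_dim_flat_of_kGeneric (h : IsRelic L L' P M) (hex : Exchange L K)
    (hsat : IsAleph1Saturated L K) (hP : P.Countable) (hSM : IsStronglyMinimal L' M)
    (hA : A.Countable) {ι : Type*} [Fintype ι] {X : Set (ι → M)} (hX : A.Definable L' X)
    {a x : ι → M} (ha : a ∈ X) (had : Fintype.card ι ≤ dim L' A a) (hx : KGeneric L P A X x) :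
    Fintype.card ι * dimSet L P M ≤ dim L (P ∪ coords A) (flat x) := by
  rw [hx.2]
  exact h.le_dimSet_flat_image hex hsat hP hSM hA hX ha
    (aclIndep_univ_of_card_le_dim hSM.exchange had)

theorem definable_ne_pair {L : FirstOrder.Language.{u, v}} {K : Type w} [L.Structure K]
    {A : Set K} {ι κ : Type*} [Finite κ] (f g : κ → ι) :
    A.Definable L {y : ι → K | y ∘ f ≠ y ∘ g} := by
  have h : A.Definable L {y : ι → K | ∀ i, y (f i) = y (g i)} := by
    rw [Set.ofPred_forall]
    exact Set.definable_iInter_of_finite fun i => definable_eq_coord _ _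
  refine (congrArg (A.Definable L) (Set.ext fun y => ?_)).mp h.compl
  exact not_congr funext_iff.symm

/-- A generic point of a power of `M` is not, on the diagonal, a limit of pairs of distinct
interalgebraic points. -/
theorem IsRelic.notMem_closure_of_finite_fibers [TopologicalSpace K] (h : IsRelic L L' P M)
    (hK : IsHausdorffGeometric L K) (hex : Exchange L K) (hP : P.Countable) (hA : A.Countable)
    {κ : Type*} [Fintype κ] {x : κ → M} (hx : KGeneric L P A Set.univ x)
    {G : Set (κ ⊕ κ → M)} (hG : A.Definable L' G)
    (hacl : ∀ z ∈ G, ∀ i, z i ∈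
      acl L' (A ∪ z '' (Finset.univ.map Function.Embedding.inl : Finset (κ ⊕ κ))))
    (hne : ∀ z ∈ G, z ∘ Sum.inl ≠ z ∘ Sum.inr) : Sum.elim x x ∉ closure G := by
  intro hc
  -- Points of `G` have distinct halves, so a limit `(x, x)` would be a frontier point. But `G` is
  -- finite-to-one over its first half, so its dimension is at most that of the full power, which
  -- `x` already attains.
  have h1 := hK.dim_lt_dimSet hex (hP.union (coords_countable hA)) (h.definable_flat_image hG)
    (map_mem_closure continuous_flat hc fun z hz => ⟨z, hz, rfl⟩) (by
      rintro ⟨z, hz, hzx⟩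
      obtain rfl := flat_injective hzx
      exact hne _ hz rfl)
  refine absurd h1 (not_lt.2 (dimSet_le ?_))
  rintro _ ⟨z, hz, rfl⟩
  calc dim L (P ∪ coords A) (flat z)
      ≤ dim L (P ∪ coords A) (flat (z ∘ Sum.inl)) :=
        (h.dim_flat_le_dim_restrict hex (hacl z hz)).trans <| by
          refine dim_le_of_range_subset hex ?_
          rintro _ ⟨⟨⟨i, hi⟩, j⟩, rfl⟩
          obtain ⟨l, -, rfl⟩ := Finset.mem_map.1 hi
          exact ⟨(l, j), rfl⟩
    _ ≤ dimSet L (P ∪ coords A) (flat '' (Set.univ : Set (κ → M))) :=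
        dim_le_dimSet hex ⟨_, trivial, rfl⟩
    _ = dim L (P ∪ coords A) (flat x) := hx.2.symm
    _ ≤ dim L (P ∪ coords A) (flat (Sum.elim x x)) := by
        refine dim_le_of_range_subset hex ?_
        rintro _ ⟨p, rfl⟩
        exact ⟨(Sum.inl p.1, p.2), rfl⟩

end Main

theorem comp_sumMap {α β α' β' γ : Type*} (y : α ⊕ β → γ) (f : α' → α) (g : β' → β) :
    y ∘ Sum.map f g = Sum.elim (fun i => y (Sum.inl (f i))) fun j => y (Sum.inr (g j)) := by
  funext i
  rcases i with i | i <;> rfl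

/-! ### Excluding limits of independent pairs, and the final covering argument. -/

section Main

variable {L : FirstOrder.Language.{u, v}} {K : Type w} [L.Structure K] [TopologicalSpace K]
  {d : ℕ} {M : Set (Fin d → K)} {L' : FirstOrder.Language.{u', v'}} [L'.Structure M] {P : Set K}
  {A : Set M}

/-- A definable set on which the coordinates in the independent set `S` generate all others does not
accumulate at a coordinatewise generic point of rank at least `|S|` with two equal coordinates
indexed by `S`, unless that coordinate is algebraic. -/
theorem WeaklyDetectsClosures.notMem_closure_of_basis (hW : WeaklyDetectsClosures L L' P M)
    (h : IsRelic L L' P M) (hex : Exchange L K) (hsat : IsAleph1Saturated L K) (hP : P.Countable)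
    (hSM : IsStronglyMinimal L' M) (hA : A.Countable) {ι : Type*} [Finite ι] {S : Finset ι}
    {G : Set (ι → M)} (hG : A.Definable L' G)
    (hacl : ∀ z ∈ G, ∀ i, z i ∈ acl L' (A ∪ z '' S)) {y : ι → M} (hy : y ∈ G)
    (hyS : AclIndep L' A y S) {x : ι → M} (hgen : ∀ i, IsGeneric L P M (x i : Fin d → K))
    (hdim : S.card ≤ dim L' A x) {i j : ι} (hi : i ∈ S) (hj : j ∈ S) (hij : i ≠ j)
    (hxij : x i = x j) (hxi : x i ∉ acl L' A) : x ∉ closure G := by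
  intro hc
  obtain ⟨-, h2⟩ := hW.of_finite hex hSM.exchange hA hG hc hgen
  have hle : dimSet L' A G ≤ S.card := dimSet_le fun z hz =>
    dim_le_card_of_forall_mem_acl_image hSM.exchange (hacl z hz)
  -- The rank of `x` is at least that of `G`, so the second clause of weak detection applies. Its
  -- premise holds because `K`-generic points of `G` have dimension `|S| · dim M`, which forces
  -- independence of the coordinates in `S`.
  have hI := h2.resolve_left (not_lt.2 (hle.trans hdim)) i j hij fun z hz => by
    obtain ⟨z', hz', hzz'⟩ := hz.1
    obtain rfl := flat_injective hzz'
    exact h.indep_coords hex (hacl z' hz')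
      (h.le_dim_flat_of_generic hex hsat hP hSM hA hG hy hyS hz) hi hj hij
  rw [Indep, ← hxij] at hI
  have h0 : dim L' (A ∪ Set.range fun _ : Fin 1 => x i) (fun _ : Fin 1 => x i) = 0 :=
    (dim_eq_zero_iff hSM.exchange).2 fun _ => subset_acl (Or.inr ⟨0, rfl⟩)
  rw [h0] at hI
  exact hxi ((dim_eq_zero_iff hSM.exchange).1 hI.symm 0)

theorem WeaklyDetectsClosures.detectsMultipleIntersections
    (hW : WeaklyDetectsClosures L L' P M) (hK : IsHausdorffGeometric L K) (hP : P.Countable)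
    (h : IsRelic L L' P M) (hSM : IsStronglyMinimal L' M) :
    DetectsMultipleIntersections L L' P M := by
  classical
  have hex : Exchange L K := (hK.geometric K inferInstance).1
  have hex' := hSM.exchange
  have hsat := hK.saturated
  intro A hA m k T C U D hC hD x t u ⟨hgen, hram⟩ hind
  have hMne : Nonempty M := hSM.1.nonempty
  have hparam : ∀ {n : ℕ} {T : Set (Fin n → M)} {C : Set (Fin 2 ⊕ Fin n → M)} {t : Fin n → M},
      IsStandardFamily L' A T C → KGeneric L P A T t →
      Fintype.card (Fin n) * dimSet L P M ≤ dim L (P ∪ coords A) (flat t) := by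
    intro n T C t hC ht
    obtain ⟨s, hs, -⟩ := ht.1
    -- `T` has full `M`-rank, so it contains an `M`-independent tuple; its `K`-generics are then
    -- generic in the whole power of `M`.
    obtain ⟨a, ha, had⟩ := exists_dim_eq_dimSet (L := L') (A := A) hex' ⟨s, hs⟩
    refine h.le_dim_flat_of_kGeneric hex hsat hP hSM hA hC.definable_param ha ?_ ht
    rw [had, hC.generic_param, Fintype.card_fin]
  have hD0 := h.dimSet_pos hex hsat hP hSM.1
  have ht := hparam hC hgen.generic_left
  have hu := hparam hD hgen.generic_right
  have hx : Fintype.card (Fin 2) * dimSet L P M ≤ dim L (P ∪ coords A) (flat x) := by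
    obtain ⟨a, ha⟩ := h.exists_le_dim_flat hex hsat hMne
      (hP.union (coords_countable hA)) Set.subset_union_left (Fin 2)
    exact h.le_dim_flat_of_kGeneric hex hsat hP hSM hA Set.definable_univ (Set.mem_univ a)
      ((h.aclIndep_univ_of_le_dim_flat hex hex' hD0 ha).card_le_dim hex') hgen.generic_point
  have htd := (h.aclIndep_univ_of_le_dim_flat hex hex' hD0 ht).card_le_dim hex'
  have hud := (h.aclIndep_univ_of_le_dim_flat hex hex' hD0 hu).card_le_dim hex'
  have hxd := (h.aclIndep_univ_of_le_dim_flat hex hex' hD0 hx).card_le_dim hex'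
  rw [Finset.card_univ, Fintype.card_fin] at htd hud
  rw [Finset.card_univ] at hxd
  have htu : m + k ≤ dim L' A (Sum.elim t u) := by
    rw [dim_sumElim hex', hind]
    omega
  have htugen : ∀ i, IsGeneric L P M ((Sum.elim t u i : M) : Fin d → K) := by
    rintro (i | i)
    · exact coord_generic_of_le_dim_flat hex ht i
    · exact coord_generic_of_le_dim_flat hex hu i
  let y₀ : (Fin 2 ⊕ Fin 2) ⊕ (Fin m ⊕ Fin k) → M := Sum.elim (Sum.elim x x) (Sum.elim t u)
  have hy₀gen : ∀ i, IsGeneric L P M (y₀ i : Fin d → K) := by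
    rintro ((i | i) | i)
    · exact coord_generic_of_le_dim_flat hex hx i
    · exact coord_generic_of_le_dim_flat hex hx i
    · exact htugen i
  have hy₀dim : m + k ≤ dim L' A y₀ := htu.trans <| dim_le_of_range_subset hex' <| by
    rintro _ ⟨i, rfl⟩
    exact ⟨Sum.inr i, rfl⟩
  let X : Set ((Fin 2 ⊕ Fin 2) ⊕ (Fin m ⊕ Fin k) → M) :=
    {y | y ∘ (fun i => Sum.inl (Sum.inl i)) ≠ y ∘ (fun i => Sum.inl (Sum.inr i))} ∩
    ((fun y => y ∘ Sum.map Sum.inl Sum.inl) ⁻¹' C ∩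
      (fun y => y ∘ Sum.map Sum.inl Sum.inr) ⁻¹' D ∩
      ((fun y => y ∘ Sum.map Sum.inr Sum.inl) ⁻¹' C ∩
      (fun y => y ∘ Sum.map Sum.inr Sum.inr) ⁻¹' D))
  have hX : A.Definable L' X := (definable_ne_pair _ _).inter
    (((hC.definable_graph.preimage_comp _).inter (hD.definable_graph.preimage_comp _)).inter
      ((hC.definable_graph.preimage_comp _).inter (hD.definable_graph.preimage_comp _)))
  have hy₀X : y₀ ∈ closure X := by
    -- `Φ` keeps both plane points but only one copy of the parameters, which the two members of a
    -- ramifying pair share. It sends the diagonal point to `y₀` and ramifying pairs into `X`.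
    let Φ : ((Fin 2 → M) × (Fin m → M) × (Fin k → M)) ×
        ((Fin 2 → M) × (Fin m → M) × (Fin k → M)) → (Fin 2 ⊕ Fin 2) ⊕ (Fin m ⊕ Fin k) → M :=
      fun p => Sum.elim (Sum.elim p.1.1 p.2.1) (Sum.elim p.1.2.1 p.1.2.2)
    have hΦ : Continuous Φ := by
      refine continuous_pi ?_
      rintro ((i | i) | (i | i)) <;> simp only [Φ, Sum.elim_inl, Sum.elim_inr] <;> fun_prop
    refine map_mem_closure (f := Φ) hΦ hram.2 ?_
    rintro ⟨⟨x₁, t₁, u₁⟩, ⟨x₂, t₂, u₂⟩⟩ ⟨⟨h1, h2⟩, ⟨h3, h4⟩, hne, heq⟩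
    obtain ⟨rfl, rfl⟩ := Prod.mk.inj heq
    refine ⟨fun hxx => hne (by rw [show x₁ = x₂ from hxx]), ⟨?_, ?_⟩, ?_, ?_⟩
    · rw [Set.mem_preimage, comp_sumMap]
      exact h1
    · rw [Set.mem_preimage, comp_sumMap]
      exact h2
    · rw [Set.mem_preimage, comp_sumMap]
      exact h3
    · rw [Set.mem_preimage, comp_sumMap]
      exact h4
  suffices hgood : ∀ y ∈ X, ∃ G, A.Definable L' G ∧ y ∈ G ∧ y₀ ∉ closure G by
    obtain ⟨𝓖, h𝓖, hf, hcov⟩ := h.exists_finite_cover hsat hP hA hX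
      (𝓕 := {G | A.Definable L' G ∧ y₀ ∉ closure G}) (fun G hG => hG.1) fun y hy => by
        obtain ⟨G, hG, hyG, hn⟩ := hgood y hy
        exact ⟨G, ⟨hG, hn⟩, hyG⟩
    have := closure_mono hcov hy₀X
    rw [hf.closure_sUnion] at this
    simp only [Set.mem_iUnion] at this
    obtain ⟨G, hG, hyG⟩ := this
    exact (h𝓖 hG).2 hyG
  rintro y ⟨hne, ⟨h1, h2⟩, h3, h4⟩
  set x₁ : Fin 2 → M := fun i => y (Sum.inl (Sum.inl i)) with hx₁
  set x₂ : Fin 2 → M := fun i => y (Sum.inl (Sum.inr i)) with hx₂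
  set s : Fin m → M := fun i => y (Sum.inr (Sum.inl i)) with hs
  set w : Fin k → M := fun i => y (Sum.inr (Sum.inr i)) with hw
  have h1' : Sum.elim x₁ s ∈ C := by
    rwa [Set.mem_preimage, comp_sumMap] at h1
  have h2' : Sum.elim x₁ w ∈ D := by
    rwa [Set.mem_preimage, comp_sumMap] at h2
  have h3' : Sum.elim x₂ s ∈ C := by
    rwa [Set.mem_preimage, comp_sumMap] at h3
  have h4' : Sum.elim x₂ w ∈ D := by
    rwa [Set.mem_preimage, comp_sumMap] at h4
  have hsw : y ∘ Sum.inr = Sum.elim s w := by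
    funext i; rcases i with i | i <;> rfl
  rcases lt_or_ge (dim L' A (Sum.elim s w)) (m + k) with hlt | hge
  -- Dependent parameters: spanning by the fewer than `m + k` coordinates in `S` persists on a
  -- definable set, whose closure cannot contain the full-rank point `(t, u)`.
  · obtain ⟨S, -, hS, hd⟩ := exists_basis (L := L') hex' A (Sum.elim s w)
    obtain ⟨G, hG, hyG, hacl⟩ := exists_definable_forall_mem_acl hS
    refine ⟨_, hG.preimage_comp Sum.inr, by rwa [Set.mem_preimage, hsw], fun hc => ?_⟩
    have hcl : Sum.elim t u ∈ closure G :=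
      map_mem_closure (f := fun y : (Fin 2 ⊕ Fin 2) ⊕ (Fin m ⊕ Fin k) → M => y ∘ Sum.inr)
        (continuous_pi fun i => continuous_apply _) hc fun y hy => hy
    have hle : dimSet L' A G ≤ S.card := dimSet_le fun z hz =>
      dim_le_card_of_forall_mem_acl_image hex' (hacl z hz)
    have := (hW.of_finite hex hex' hA hG hcl htugen).1
    omega
  · have hx₁d := hC.two_le_dim_of_mem_inter hD hex' h1' h2' hge
    have ha₁ := hC.mem_acl_of_mem_inter hD hex' h1' h2' hge
    have ha₂ := hC.mem_acl_of_mem_inter hD hex' h3' h4' hge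
    by_cases hfib : ∀ i, x₂ i ∈ acl L' (A ∪ Set.range x₁)
    -- Here the parameters can be forgotten: algebraicity of the second point over the first is
    -- spread to a definable set of pairs, and distinctness is imposed separately.
    · have himg : (y ∘ Sum.inl) '' (Finset.univ.map Function.Embedding.inl :
          Finset (Fin 2 ⊕ Fin 2)) = Set.range x₁ := by
        ext z; simp [hx₁]
      obtain ⟨G, hG, hyG, hacl⟩ := exists_definable_forall_mem_acl (L := L') (A := A)
        (a := y ∘ Sum.inl) (S := (Finset.univ.map Function.Embedding.inl :
          Finset (Fin 2 ⊕ Fin 2))) (by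
          rw [himg]
          rintro (i | i)
          · exact subset_acl (Or.inr ⟨i, rfl⟩)
          · exact hfib i)
      have hE := hG.inter (definable_ne_pair (Sum.inl : Fin 2 → Fin 2 ⊕ Fin 2) Sum.inr)
      refine ⟨_, hE.preimage_comp Sum.inl, ⟨hyG, hne⟩, fun hc => ?_⟩
      refine h.notMem_closure_of_finite_fibers hK hex hP hA hgen.generic_point hE
        (fun z hz => hacl z hz.1) (fun z hz => hz.2) ?_
      exact map_mem_closure (f := fun y : (Fin 2 ⊕ Fin 2) ⊕ (Fin m ⊕ Fin k) → M => y ∘ Sum.inl)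
        (continuous_pi fun i => continuous_apply _) hc fun y hy => hy
    · obtain ⟨i, hi⟩ := not_forall.1 hfib
      -- The same index `i` is used in both points, so that the two basis coordinates become equal
      -- at `y₀`.
      have hS₁ : AclIndep L' A y {Sum.inl (Sum.inl i)} := by
        rw [← insert_empty_eq]
        refine aclIndep_empty.insert hex' ?_
        simpa using notMem_acl_of_card_le_dim hex' (by simpa using hx₁d) i
      have hS₂ := hS₁.insert hex' (i := Sum.inl (Sum.inr i)) fun hc => hi <| by
        refine acl_mono (Set.union_subset_union_right _ ?_) hc
        rintro _ ⟨j, hj, rfl⟩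
        obtain rfl := Finset.mem_singleton.1 hj
        exact ⟨i, rfl⟩
      obtain ⟨S, hsub, hS, hacl⟩ := hS₂.exists_basis hex'
      obtain ⟨G, hG, hyG, hGacl⟩ := exists_definable_forall_mem_acl hacl
      refine ⟨G, hG, hyG, ?_⟩
      refine hW.notMem_closure_of_basis h hex hsat hP hSM hA hG hGacl hyG hS hy₀gen ?_
        (i := Sum.inl (Sum.inl i)) (j := Sum.inl (Sum.inr i))
        (hsub (by simp)) (hsub (by simp)) (by simp) rfl ?_
      -- Both plane points are algebraic over `s, w`, so `|S| ≤ rk(y) ≤ rk(s, w) ≤ m + k ≤ rk(y₀)`: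
      -- no rank is lost in the limit.
      · refine (hS.card_le_dim hex').trans (le_trans ?_ hy₀dim)
        have hyd : dim L' A y ≤ dim L' A (Sum.elim s w) := by
          refine dim_le_of_forall_mem_acl hex' ?_
          rintro ((j | j) | j)
          · exact ha₁ j
          · exact ha₂ j
          · exact subset_acl (Or.inr ⟨j, congrFun hsw.symm j⟩)
        have := dim_le_card (L := L') hex' A (Sum.elim s w)
        simp only [Fintype.card_sum, Fintype.card_fin] at this
        omega
      · exact notMem_acl_of_card_le_dim hex' hxd i

end Main
end HGS

theorem theoremT (L : FirstOrder.Language.{u, v}) (K : Type w) [L.Structure K]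
    [TopologicalSpace K] (hK : HGS.IsHausdorffGeometric L K)
    (P : Set K) (hP : P.Countable)
    (d : ℕ) (M : Set (Fin d → K)) (L' : FirstOrder.Language.{u', v'}) [L'.Structure M]
    (hrelic : HGS.IsRelic L L' P M)
    (hSM : HGS.IsStronglyMinimal L' M)
    (hNLM : HGS.NotLocallyModular L' M)
    (hWDC : HGS.WeaklyDetectsClosures L L' P M) :
    HGS.DetectsMultipleIntersections L L' P M :=
  hWDC.detectsMultipleIntersections hK hP hrelic hSM
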